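/- \textbf{Setting.} Let $d\in\{2,3\}$, $T>0$, and let $\Omega\subset\mathbb R^d$ be a bounded open set that is the interior of a finite union of closed boxes with edges parallel to the axes. Let $u_0\in L^2(\Omega)^d$, let $\rho_0$ be measurable with $0<\rho_{\min}\le\rho_0\le\rho_{\max}<\infty$ a.e. in $\Omega$, let $\mu$ be continuous and positive on $[\rho_{\min},\rho_{\max}]$, and let $f\in L^2(0,T;L^2(\Omega)^d)$. \textbf{Grid.} $\overline\Omega$ is the union of a finite set $\mathcal M$ of closed cells of a non-uniform Cartesian (tensor-product) grid. $|\cdot|$ is the Lebesgue measure in dimension $d$ or $d-1$. $\mathcal E^{(i)}$ is the set of faces of cells that are orthogonal to $e_i$; such a face is interior, $\sigma=K|L$, if it is common to two cells $K,L$ of $\mathcal M$ (then $L$ is on the side of $+e_i$ here), and exterior otherwise. $D_\sigma$ is the union of the halves, adjacent to $\sigma$, of the cells next to $\sigma$; $x_\sigma$ is the centre of $\sigma$. Each face $\varepsilon$ of the $i$-th dual mesh $(D_\sigma)_{\sigma\in\mathcal E^{(i)}}$ that is orthogonal to $e_j$ separates $\sigma,\sigma'\in\mathcal E^{(i)}$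 consecutive in direction $e_j$ (in case $j=i$, $\varepsilon$ is the mid-plane of a cell with faces $\sigma,\sigma'$), or, only if $j\ne i$, it is adjacent to only one $\sigma\in\mathcal E^{(i)}$; a missing $\sigma'$ has value $0$ below. $d_\varepsilon$ is the distance from $x_\sigma$ to $x_{\sigma'}$, or from $x_\sigma$ to $\varepsilon$ if $\sigma'$ is missing. For $j\neq i$, the dual face $\varepsilon$ is centred at a common edge (a vertex if $d=2$) of at most four cells; its extent in direction $e_i$ is the number $d_{\varepsilon'}$ of the dual face $\varepsilon'$ orthogonal to $e_i$ of the $j$-th dual mesh at the same edge. (So at a re-entrant edge $\varepsilon$ is the full side of $D_\sigma$.) \textbf{Discrete functions.} $L_{\mathcal M}$ is the space of families $(q_K)_{K\in\mathcal M}$, and $\mathbf H_{\mathcal E,0}$ that of $u=(u_i)_{1\le i\le d}$, $u_i=\sum_{\sigma\in\mathcal E^{(i)}}u_\sigma\mathbf 1_{D_\sigma}$ with $u_\sigma=0$ on exterior faces. Put $$\|u\|_{1,\mathcal E,0}^2=\sum_{i,j=1}^d\ \sum_{\varepsilon\perp e_j}\frac{|\varepsilon|}{d_\varepsilon}(u_\sigma-u_{\sigma'})^2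 ,$$ the inner sum running over the faces of the $i$-th dual mesh orthogonal to $e_j$. \textbf{Scheme.} Let $N\ge1$, $\delta t=T/N$, $t^n=n\,\delta t$. Let $\rho^0_K$ be the mean of $\rho_0$ over $K$ and, on interior faces, $u^0_\sigma$ the mean of the component $(u_0)_i$ over $D_\sigma$ ($u^0_\sigma=0$ on exterior faces). A discrete solution consists of $\rho^{n+1}\in L_{\mathcal M}$, $u^{n+1}\in\mathbf H_{\mathcal E,0}$ and $p^{n+1}\in L_{\mathcal M}$ with $\sum_K|K|p^{n+1}_K=0$, such that for $0\le n\le N-1$, every $K\in\mathcal M$, every $i$ and every interior $\sigma=K|L\in\mathcal E^{(i)}$ $$\frac{\rho_K^{n+1}-\rho_K^n}{\delta t}+\frac1{|K|}\sum_{\sigma\subset\partial K}F^{n+1}_{K,\sigma}=0,\qquad \sum_{\sigma\subset\partial K}|\sigma|u^{n+1}_{K,\sigma}=0,$$ $$\frac{\rho_{D_\sigma}^{n+1}u_\sigma^{n+1}-\rho_{D_\sigma}^{n}u_\sigma^{n}}{\delta t}+\frac1{|D_\sigma|}\sum_{\varepsilon\subset\partial D_\sigma}F^{n+1}_{\sigma,\varepsilon}u^{n+1}_\varepsilon-\frac1{|D_\sigma|}\sum_{j}\sum_{\varepsilon\subset\partial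 D_\sigma,\,\varepsilon\perp e_j}|\varepsilon|\,\mu^{n+1}_\varepsilon\,\frac{(\eth_ju_i+\eth_iu_j)^{n+1}_\varepsilon}{2}\,(n_{\sigma,\varepsilon}\cdot e_j)+\frac{|\sigma|}{|D_\sigma|}(p^{n+1}_L-p^{n+1}_K)=f^{n+1}_\sigma .$$ Here $u_{K,\sigma}=u_\sigma\,n_{K,\sigma}\cdot e_i$ for $\sigma\in\mathcal E^{(i)}$, with $n$ denoting outward unit normals; $F_{K,\sigma}=|\sigma|\rho_\sigma u_{K,\sigma}$, with $\rho_\sigma$ the upwind value ($\rho_K$ if $u_{K,\sigma}\ge0$, the value in the other cell otherwise), and $F_{K,\sigma}=0$ on exterior faces; $|D_\sigma|\rho_{D_\sigma}=\frac{|K|}2\rho_K+\frac{|L|}2\rho_L$. If $\varepsilon\perp e_i$ separates $\sigma$ and $\sigma'$ inside a cell $Q$, then $F_{\sigma,\varepsilon}=\frac12(-F_{Q,\sigma}+F_{Q,\sigma'})$; if $\varepsilon\perp e_j$, $j\ne i$, then $F_{\sigma,\varepsilon}=\frac12(F_{K,\tau}+F_{L,\tau'})$, where $\tau\subset\partial K$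 and $\tau'\subset\partial L$ are the faces orthogonal to $e_j$ on the side of $\varepsilon$; $u_\varepsilon$ is the upwind value ($u_\sigma$ if $F_{\sigma,\varepsilon}\ge0$, $u_{\sigma'}$ otherwise). $(\eth_ju_i)_\varepsilon=\frac{u_{\sigma'}-u_\sigma}{d_\varepsilon}\,n_{\sigma,\varepsilon}\cdot e_j$, and $(\eth_iu_j)_\varepsilon$ is the quotient defined in this way for the component $u_j$ at the same edge (the same cell, if $j=i$). Finally $\mu_\varepsilon=\mu(\rho_Q)$ if $j=i$ and $\varepsilon$ is in the cell $Q$, while for $j\ne i$, $\mu_\varepsilon$ is the mean, weighted by $|Q|$, of $\mu(\rho_Q)$ over the (at most four) cells $Q\in\mathcal M$ around the edge. \textbf{Source term.} Either (a) $f_\sigma^{n+1}$, $\sigma\in\mathcal E^{(i)}$, is the mean of $f_i$ over $(t^n,t^{n+1})\times D_\sigma$; or (b) $f^{n+1}_\sigma$ is the mean of $f_i(t^{n+1},\cdot)$ over $D_\sigma$, and in this case it is assumed that $f(t,\cdot)\in L^2(\Omega)^d$ for every $t\in(0,T]$ and that the sums $\sum_{n=0}^{N-1}\frac TN\|f((n+1)T/N,\cdot)\|_{L^2(\Omega)^d}^2$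 are bounded over $N\ge1$ (for instance $f\in C([0,T];L^2(\Omega)^d)$). \textbf{Lemma.} In each of the cases (a) and (b) there is a constant $C>0$, depending only on the data $\Omega$, $T$, $u_0$, $\rho_0$ (with its bounds $\rho_{\min},\rho_{\max}$), $\mu$ and $f$, but not on the grid nor on $N$, such that every discrete solution satisfies $$\sum_{n=0}^{N-1}\delta t\,\|u^{n+1}\|_{1,\mathcal E,0}^2\le C\qquad\text{and}\qquad\max_{0\le n\le N-1}\|u^{n+1}\|_{L^2(\Omega)^d}\le C .$$ -/

import Mathlib

open MeasureTheory Set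

noncomputable section

/-- Multi-indices of the cells and faces of a Cartesian grid. -/
abbrev MACIdx (d : ℕ) : Type := Fin d → ℤ

/-- The multi-index of one step in direction `i`. -/
def macStep {d : ℕ} (i : Fin d) : MACIdx d := Pi.single i 1

/-- A (non-uniform) MAC grid of `Ω`: strictly increasing grid abscissae in each coordinate
direction, and the finite set `cells` of those cells
`K = ∏ i, [node i (K i), node i (K i + 1)]` of the Cartesian grid that make up `Ω`. -/
structure MACGrid (d : ℕ) (Ω : Set (EuclideanSpace ℝ (Fin d))) where
  node : Fin d → ℤ → ℝ
  node_strictMono : ∀ i, StrictMono (node i)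
  cells : Finset (MACIdx d)
  domain_eq : Ω = interior (⋃ K ∈ cells,
    {x : EuclideanSpace ℝ (Fin d) | ∀ i, x i ∈ Icc (node i (K i)) (node i (K i + 1))})

namespace MACGrid

variable {d : ℕ} {Ω : Set (EuclideanSpace ℝ (Fin d))} (G : MACGrid d Ω)

/-! ### Geometry -/

/-- Width in direction `i` of the `k`-th slab. -/
def width (i : Fin d) (k : ℤ) : ℝ := G.node i (k + 1) - G.node i k

/-- Midpoint in direction `i` of the `k`-th slab. -/
def mid (i : Fin d) (k : ℤ) : ℝ := (G.node i k + G.node i (k + 1)) / 2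

/-- The (closed) primal cell `K`. -/
def cell (K : MACIdx d) : Set (EuclideanSpace ℝ (Fin d)) :=
  {x | ∀ i, x i ∈ Icc (G.node i (K i)) (G.node i (K i + 1))}

/-- The measure `|K|` of a primal cell. -/
def cellVol (K : MACIdx d) : ℝ := ∏ i, G.width i (K i)

/-- The faces orthogonal to the `i`-th basis vector. The index `K` stands for the face that
separates the positions `K - macStep i` and `K`; it is a face of the mesh if at least one of these
two positions is a cell. -/
def faces (i : Fin d) : Finset (MACIdx d) := G.cells ∪ G.cells.image (· + macStep i)

/-- The interior faces orthogonal to the `i`-th basis vector: both sides are cells. -/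
def intFaces (i : Fin d) : Finset (MACIdx d) := G.cells ∩ G.cells.image (· + macStep i)

/-- The `(d-1)`-dimensional measure `|σ|` of the face `σ = (i, K)`. -/
def faceArea (i : Fin d) (K : MACIdx d) : ℝ := ∏ k ∈ Finset.univ.erase i, G.width k (K k)

/-- The dual cell `D_σ` of the interior face `σ = (i, K)`: the union of the two halves, adjacent
to `σ`, of the cells `K - macStep i` and `K`. -/
def dualCell (i : Fin d) (K : MACIdx d) : Set (EuclideanSpace ℝ (Fin d)) :=
  {x | x i ∈ Icc (G.mid i (K i - 1)) (G.mid i (K i)) ∧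
    ∀ k, k ≠ i → x k ∈ Icc (G.node k (K k)) (G.node k (K k + 1))}

/-- The measure `|D_σ|` for an interior face `σ = (i, K)`. -/
def dualVol (i : Fin d) (K : MACIdx d) : ℝ :=
  (G.cellVol K + G.cellVol (K - macStep i)) / 2

/-- The faces `ε` of the `i`-th dual mesh that are orthogonal to the `j`-th basis vector. The index
`K` stands for the dual face between the `i`-faces `K - macStep j` and `K`. For `j = i` these are
the mid-planes of the cells `K - macStep i`; for `j ≠ i` one of the two `i`-faces may be absent
(dual face on the boundary). -/
def dualFaces (i j : Fin d) : Finset (MACIdx d) :=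
  if i = j then G.cells.image (· + macStep i)
  else G.faces i ∪ (G.faces i).image (· + macStep j)

/-- `d_ε` for the dual face `ε = (i, j, K)`: the distance of the centres of the two `i`-faces on
both sides of `ε`, or the distance of the centre of the only one to `ε` if the other is absent. -/
def dualDist (i j : Fin d) (K : MACIdx d) : ℝ :=
  if i = j then G.width i (K i - 1)
  else (if K ∈ G.faces i then G.width j (K j) / 2 else 0) +
    (if K - macStep j ∈ G.faces i then G.width j (K j - 1) / 2 else 0)

/-- The `(d-1)`-dimensional measure `|ε|` of the dual face `ε = (i, j, K)`. For `j ≠ i` its extent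
in direction `i` is the distance between the `j`-faces that it joins. -/
def dualArea (i j : Fin d) (K : MACIdx d) : ℝ :=
  if i = j then G.faceArea i K
  else G.dualDist j i K * ∏ k ∈ (Finset.univ.erase i).erase j, G.width k (K k)

/-! ### Discrete functions -/

/-- Membership in `H_{E,0}`: a velocity is given by its degrees of freedom `u i K` on the faces
`(i, K)`, and these vanish on the exterior faces (and, by convention, off the mesh). -/
def IsVelocity (u : Fin d → MACIdx d → ℝ) : Prop := ∀ i K, K ∉ G.intFaces i → u i K = 0

/-- The vector field on `Ω`, piecewise constant on the dual cells, defined by the degrees of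
freedom `u`. -/
def velocityField (u : Fin d → MACIdx d → ℝ) (x : EuclideanSpace ℝ (Fin d)) :
    EuclideanSpace ℝ (Fin d) :=
  WithLp.toLp 2 fun i => ∑ K ∈ G.intFaces i, (G.dualCell i K).indicator (fun _ => u i K) x

/-- The projection onto `H_{E,0}`: mean values of the components on the dual cells. -/
def projVelocity (v : EuclideanSpace ℝ (Fin d) → EuclideanSpace ℝ (Fin d))
    (i : Fin d) (K : MACIdx d) : ℝ :=
  if K ∈ G.intFaces i then ⨍ x in G.dualCell i K, v x i else 0

/-- The projection onto `L_M`: mean values on the primal cells. -/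
def projCell (q : EuclideanSpace ℝ (Fin d) → ℝ) (K : MACIdx d) : ℝ := ⨍ x in G.cell K, q x

/-- The difference quotient `(ð_j u_i)` on the dual-dual cell of `ε = (i, j, K)`. -/
def grad (u : Fin d → MACIdx d → ℝ) (i j : Fin d) (K : MACIdx d) : ℝ :=
  (u i K - u i (K - macStep j)) / G.dualDist i j K

/-- The square of the discrete `H¹₀` norm, `∑_i ∑_ε |ε| / d_ε (u_σ - u_σ')²`, with the value `0` in
place of the one on an absent face. -/
def normSq (u : Fin d → MACIdx d → ℝ) : ℝ :=
  ∑ i, ∑ j, ∑ K ∈ G.dualFaces i j,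
    G.dualArea i j K / G.dualDist i j K * (u i K - u i (K - macStep j)) ^ 2

/-! ### Discrete operators -/

/-- The discrete divergence on the cell `K`. -/
def div (u : Fin d → MACIdx d → ℝ) (K : MACIdx d) : ℝ :=
  (G.cellVol K)⁻¹ * ∑ i, (G.faceArea i (K + macStep i) * u i (K + macStep i) -
    G.faceArea i K * u i K)

/-- The upwind mass flux through the face `(i, K)`, counted in the direction of the `i`-th basis
vector. -/
def massFlux (ρ : MACIdx d → ℝ) (u : Fin d → MACIdx d → ℝ) (i : Fin d) (K : MACIdx d) : ℝ :=
  G.faceArea i K * (if 0 ≤ u i K then ρ (K - macStep i) else ρ K) * u i K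

/-- `div_M (ρ u)` on the cell `K`. -/
def divMass (ρ : MACIdx d → ℝ) (u : Fin d → MACIdx d → ℝ) (K : MACIdx d) : ℝ :=
  (G.cellVol K)⁻¹ * ∑ i, (G.massFlux ρ u i (K + macStep i) - G.massFlux ρ u i K)

/-- The density `ρ_{D_σ}` on the dual cell of the interior face `σ = (i, K)`. -/
def dualDensity (ρ : MACIdx d → ℝ) (i : Fin d) (K : MACIdx d) : ℝ :=
  (G.cellVol K / 2 * ρ K + G.cellVol (K - macStep i) / 2 * ρ (K - macStep i)) / G.dualVol i K

/-- The mass flux through the dual face `(i, j, K)`, counted in the direction of the `j`-th basis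
vector. For `j = i` this is the mean of the fluxes through the two `i`-faces of the cell
`K - macStep i`; for `j ≠ i` it is half the sum of the fluxes through the `j`-faces of the
neighbouring positions `K - macStep i` and `K`. -/
def dualMassFlux (ρ : MACIdx d → ℝ) (u : Fin d → MACIdx d → ℝ) (i j : Fin d) (K : MACIdx d) : ℝ :=
  (G.massFlux ρ u j K + G.massFlux ρ u j (K - macStep i)) / 2

/-- The upwind momentum flux through the dual face `(i, j, K)`, counted in the direction of the
`j`-th basis vector. -/
def momentumFlux (ρ : MACIdx d → ℝ) (u : Fin d → MACIdx d → ℝ) (i j : Fin d) (K : MACIdx d) : ℝ :=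
  G.dualMassFlux ρ u i j K *
    (if 0 ≤ G.dualMassFlux ρ u i j K then u i (K - macStep j) else u i K)

/-- The convection operator on the dual cell of the interior face `(i, K)`. -/
def convection (ρ : MACIdx d → ℝ) (u : Fin d → MACIdx d → ℝ) (i : Fin d) (K : MACIdx d) : ℝ :=
  (G.dualVol i K)⁻¹ *
    ∑ j, (G.momentumFlux ρ u i j (K + macStep j) - G.momentumFlux ρ u i j K)

/-- The viscosity `μ_ε` on the dual face `ε = (i, j, K)`: the value of the cell containing `ε` if
`j = i`, and the mean of the values of the (at most four) cells around the common edge, weighted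
by their measures, if `j ≠ i`. -/
def dualViscosity (μ : ℝ → ℝ) (ρ : MACIdx d → ℝ) (i j : Fin d) (K : MACIdx d) : ℝ :=
  if i = j then μ (ρ (K - macStep i))
  else
    (∑ L ∈ ({K, K - macStep i, K - macStep j, K - macStep i - macStep j} :
        Finset (MACIdx d)) ∩ G.cells, G.cellVol L * μ (ρ L)) /
      ∑ L ∈ ({K, K - macStep i, K - macStep j, K - macStep i - macStep j} :
        Finset (MACIdx d)) ∩ G.cells, G.cellVol L

/-- The viscous flux `|ε| μ_ε (ð_j u_i + ð_i u_j) / 2` through the dual face `ε = (i, j, K)`, counted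
in the direction of the `j`-th basis vector. -/
def viscousFlux (μ : ℝ → ℝ) (ρ : MACIdx d → ℝ) (u : Fin d → MACIdx d → ℝ)
    (i j : Fin d) (K : MACIdx d) : ℝ :=
  G.dualArea i j K * G.dualViscosity μ ρ i j K * ((G.grad u i j K + G.grad u j i K) / 2)

/-- The diffusion operator on the dual cell of the interior face `(i, K)`. -/
def diffusion (μ : ℝ → ℝ) (ρ : MACIdx d → ℝ) (u : Fin d → MACIdx d → ℝ)
    (i : Fin d) (K : MACIdx d) : ℝ :=
  (G.dualVol i K)⁻¹ *
    ∑ j, (G.viscousFlux μ ρ u i j (K + macStep j) - G.viscousFlux μ ρ u i j K)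

/-- The discrete pressure gradient on the dual cell of the interior face `(i, K)`. -/
def pressureGrad (p : MACIdx d → ℝ) (i : Fin d) (K : MACIdx d) : ℝ :=
  G.faceArea i K / G.dualVol i K * (p K - p (K - macStep i))

/-! ### The scheme -/

/-- `(ρ^n, u^n, p^n)`, `0 ≤ n ≤ N`, is a solution of the implicit scheme with time step `τ`,
viscosity law `μ`, initial data `ρ₀`, `u₀`, and discrete source term `g n` at the step from `n` to
`n + 1`. Cell functions `ρ n`, `p n` enter through their values on the cells only. -/
structure IsDiscreteSolution (τ : ℝ) (N : ℕ) (μ : ℝ → ℝ)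
    (ρ₀ : EuclideanSpace ℝ (Fin d) → ℝ)
    (u₀ : EuclideanSpace ℝ (Fin d) → EuclideanSpace ℝ (Fin d))
    (g : ℕ → Fin d → MACIdx d → ℝ)
    (ρ : ℕ → MACIdx d → ℝ) (u : ℕ → Fin d → MACIdx d → ℝ) (p : ℕ → MACIdx d → ℝ) : Prop where
  density_zero : ∀ K ∈ G.cells, ρ 0 K = G.projCell ρ₀ K
  velocity_zero : u 0 = G.projVelocity u₀
  velocity_mem : ∀ n < N, G.IsVelocity (u (n + 1))
  pressure_mean : ∀ n < N, ∑ K ∈ G.cells, G.cellVol K * p (n + 1) K = 0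
  mass : ∀ n < N, ∀ K ∈ G.cells,
    (ρ (n + 1) K - ρ n K) / τ + G.divMass (ρ (n + 1)) (u (n + 1)) K = 0
  momentum : ∀ n < N, ∀ i, ∀ K ∈ G.intFaces i,
    (G.dualDensity (ρ (n + 1)) i K * u (n + 1) i K - G.dualDensity (ρ n) i K * u n i K) / τ
      + G.convection (ρ (n + 1)) (u (n + 1)) i K
      - G.diffusion μ (ρ (n + 1)) (u (n + 1)) i K
      + G.pressureGrad (p (n + 1)) i K = g n i K
  incompressible : ∀ n < N, ∀ K ∈ G.cells, G.div (u (n + 1)) K = 0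

/-- The source term sampled in time: the projection of `f (t^{n+1}, ·)`, `t^{n+1} = (n + 1) τ`. -/
def sampledSource (τ : ℝ)
    (f : ℝ → EuclideanSpace ℝ (Fin d) → EuclideanSpace ℝ (Fin d))
    (n : ℕ) (i : Fin d) (K : MACIdx d) : ℝ :=
  G.projVelocity (f ((n + 1) * τ)) i K

/-- The source term averaged in time: the mean over `(t^n, t^{n+1})` of the projections of
`f (t, ·)`. -/
def averagedSource (τ : ℝ)
    (f : ℝ → EuclideanSpace ℝ (Fin d) → EuclideanSpace ℝ (Fin d))
    (n : ℕ) (i : Fin d) (K : MACIdx d) : ℝ :=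
  τ⁻¹ * ∫ t in (n * τ)..((n + 1) * τ), G.projVelocity (f t) i K

end MACGrid

end

/-! ### Positivity and index arithmetic on the grid -/

namespace MACGrid

variable {d : ℕ} {Ω : Set (EuclideanSpace ℝ (Fin d))} (G : MACGrid d Ω)

/-! The bound is the discrete kinetic energy balance, obtained by testing the momentum equation at
step `n + 1` with the new velocity, weighted by `dualVol`.

Upwinding and zero divergence give a maximum principle (`IsDiscreteSolution.density_mem`), so the
density stays between its initial bounds and the viscosity above some `m > 0`. Averaging the mass
balances of the two cells next to a face gives a mass balance on the dual cell with exactly the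
fluxes used in the convection term (`dual_massBalance`). With it, time derivative plus upwind
convection dominate the increment of the kinetic energy. The pressure term vanishes by duality with
the divergence (`sum_pressureGrad`).

The viscous term sees only the symmetric gradient, so a Korn identity is needed. Summing by parts
twice, the cross terms `(ð_j u_i)(ð_i u_j)` add up to the squared divergence, which is zero
(`sum_grad_mul_grad_comm`, `sum_fwdGrad`). The symmetric gradient therefore carries exactly half of
`normSq` (`sum_sq_symGrad`). The geometric point is that the volume `|ε| d_ε` is symmetric in the
two directions, even at the boundary and at re-entrant edges.

Adding the steps (`kinetic_step`) gives `IsDiscreteSolution.energy_le`, whose source contribution is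
linear in the velocity. It is absorbed through the maximum in time of the `L²` norm
(`le_of_sq_add_sum_le`), without a Poincaré inequality or exponential growth. Constants are uniform
in the grid because the projections of the data are `L²` contractions (`dualInner_projVelocity_le`,
`mul_dualInner_averagedSource_le`). -/

theorem width_pos (i : Fin d) (k : ℤ) : 0 < G.width i k :=
  sub_pos.2 (G.node_strictMono i (by omega))

theorem cellVol_pos (K : MACIdx d) : 0 < G.cellVol K :=
  Finset.prod_pos fun i _ => G.width_pos i _

theorem dualVol_pos (i : Fin d) (K : MACIdx d) : 0 < G.dualVol i K := by
  have := G.cellVol_pos K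
  have := G.cellVol_pos (K - macStep i)
  unfold dualVol
  positivity

theorem dualDist_nonneg (i j : Fin d) (K : MACIdx d) : 0 ≤ G.dualDist i j K := by
  have := G.width_pos i (K i - 1)
  have := G.width_pos j (K j)
  have := G.width_pos j (K j - 1)
  unfold dualDist
  split_ifs <;> positivity

theorem macStep_apply_self (i : Fin d) : (macStep i : MACIdx d) i = 1 := by simp [macStep]

theorem macStep_apply_of_ne {i k : Fin d} (h : k ≠ i) : (macStep i : MACIdx d) k = 0 := by
  simp [macStep, h]

theorem macStep_mem (i k : Fin d) : 0 ≤ (macStep i : MACIdx d) k ∧ (macStep i : MACIdx d) k ≤ 1 := by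
  by_cases h : k = i
  · subst h; simp [macStep_apply_self]
  · simp [macStep_apply_of_ne h]

theorem faceArea_pos (i : Fin d) (K : MACIdx d) : 0 < G.faceArea i K :=
  Finset.prod_pos fun k _ => G.width_pos k _

theorem dualArea_nonneg (i j : Fin d) (K : MACIdx d) : 0 ≤ G.dualArea i j K := by
  unfold dualArea
  split_ifs
  · exact (G.faceArea_pos i K).le
  · exact mul_nonneg (G.dualDist_nonneg j i K)
      (Finset.prod_nonneg fun k _ => (G.width_pos k _).le)

theorem faceArea_add_step (i : Fin d) (K : MACIdx d) :
    G.faceArea i (K + macStep i) = G.faceArea i K := by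
  refine Finset.prod_congr rfl fun k hk => ?_
  rw [Pi.add_apply, macStep_apply_of_ne (Finset.ne_of_mem_erase hk), add_zero]

theorem width_mul_faceArea (i : Fin d) (K : MACIdx d) :
    G.width i (K i) * G.faceArea i K = G.cellVol K :=
  Finset.mul_prod_erase Finset.univ (fun k => G.width k (K k)) (Finset.mem_univ i)

theorem mem_intFaces {i : Fin d} {K : MACIdx d} :
    K ∈ G.intFaces i ↔ K ∈ G.cells ∧ K - macStep i ∈ G.cells := by
  simp only [intFaces, Finset.mem_inter, Finset.mem_image, and_congr_right_iff]
  intro _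
  constructor
  · rintro ⟨L, hL, rfl⟩; simpa using hL
  · intro h; exact ⟨_, h, by simp⟩

theorem mem_faces {i : Fin d} {K : MACIdx d} :
    K ∈ G.faces i ↔ K ∈ G.cells ∨ K - macStep i ∈ G.cells := by
  simp only [faces, Finset.mem_union, Finset.mem_image]
  refine or_congr Iff.rfl ⟨?_, fun h => ⟨_, h, by simp⟩⟩
  rintro ⟨L, hL, rfl⟩; simpa using hL

variable {G}

theorem IsVelocity.eq_zero_of_notMem {u : Fin d → MACIdx d → ℝ} (hu : G.IsVelocity u) {i : Fin d}
    {K : MACIdx d} (hK : K ∉ G.cells) : u i K = 0 :=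
  hu i K fun h => hK (G.mem_intFaces.1 h).1

theorem IsVelocity.eq_zero_of_sub_notMem {u : Fin d → MACIdx d → ℝ} (hu : G.IsVelocity u)
    {i : Fin d} {K : MACIdx d} (hK : K - macStep i ∉ G.cells) : u i K = 0 :=
  hu i K fun h => hK (G.mem_intFaces.1 h).2

theorem IsVelocity.eq_zero_of_notMem_faces {u : Fin d → MACIdx d → ℝ} (hu : G.IsVelocity u)
    {i : Fin d} {K : MACIdx d} (hK : K ∉ G.faces i) : u i K = 0 :=
  hu.eq_zero_of_notMem fun h => hK (G.mem_faces.2 (Or.inl h))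

variable (G)

/-! ### Summation over index space -/

/-- A finite set of indices containing everything at distance at most two from the mesh. -/
noncomputable def window : Finset (MACIdx d) :=
  Finset.image₂ (· + ·) G.cells (Fintype.piFinset fun _ : Fin d => Finset.Icc (-2 : ℤ) 2)

/-- The margin of two is needed because the index of a dual face may be two steps away from the
nearest cell at hand. -/
theorem mem_window {K L : MACIdx d} (hL : L ∈ G.cells) (h : ∀ k, L k - 2 ≤ K k ∧ K k ≤ L k + 2) :
    K ∈ G.window := by
  unfold window
  refine Finset.mem_image₂.2 ⟨L, hL, K - L, ?_, by simp⟩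
  simp only [Fintype.mem_piFinset, Finset.mem_Icc, Pi.sub_apply]
  intro k
  have := h k
  omega

theorem cells_subset_window : G.cells ⊆ G.window := fun K hK =>
  G.mem_window hK fun k => by omega

theorem intFaces_subset_window (i : Fin d) : G.intFaces i ⊆ G.window := fun _ hK =>
  G.cells_subset_window (G.mem_intFaces.1 hK).1

/-- Both sides are sums over the whole lattice, since the support lies in the window before and
after the shift; translation is a bijection of the lattice. -/
theorem sum_window_shift (v : MACIdx d) (f : MACIdx d → ℝ)
    (h : ∀ K, f K ≠ 0 → K ∈ G.window ∧ K - v ∈ G.window) :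
    ∑ K ∈ G.window, f (K + v) = ∑ K ∈ G.window, f K := by
  rw [← finsum_eq_sum_of_support_subset f (fun K hK => (h K hK).1),
    ← finsum_eq_sum_of_support_subset (fun K => f (K + v)) (fun K hK => by
      simpa using (h (K + v) hK).2)]
  exact finsum_comp_equiv (Equiv.addRight v)

/-- Summation by parts in direction `j` against a function supported in the mesh. -/
theorem sum_window_by_parts (j : Fin d) (w M : MACIdx d → ℝ) (hw : ∀ K, K ∉ G.cells → w K = 0) :
    ∑ K ∈ G.window, w K * (M (K + macStep j) - M K) =
      ∑ K ∈ G.window, M K * (w (K - macStep j) - w K) := by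
  have key := G.sum_window_shift (macStep j) (fun K => M K * w (K - macStep j)) (by
    intro K hK
    have hK' : K - macStep j ∈ G.cells := by
      by_contra hc
      exact hK (by simp [hw _ hc])
    refine ⟨G.mem_window hK' fun k => ?_, G.cells_subset_window hK'⟩
    have := macStep_mem j k
    simp only [Pi.sub_apply]
    omega)
  simp only [add_sub_cancel_right] at key
  simp only [mul_sub, Finset.sum_sub_distrib]
  rw [← key]
  congr 1 <;> exact Finset.sum_congr rfl fun K _ => mul_comm _ _

theorem sum_intFaces_eq_sum_window (i : Fin d) (f : MACIdx d → ℝ)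
    (hf : ∀ K, K ∉ G.intFaces i → f K = 0) :
    ∑ K ∈ G.intFaces i, f K = ∑ K ∈ G.window, f K :=
  Finset.sum_subset (G.intFaces_subset_window i) fun K _ hK => hf K hK

/-! ### Mass balance and maximum principle -/

/-- Subtract `ρ K` times the zero divergence. Outflow faces then contribute nothing, as they carry
`ρ K` itself, and inflow faces carry an upwind value that is at least `ρ K`. -/
theorem divMass_nonpos_of_forall_le {ρ : MACIdx d → ℝ} {u : Fin d → MACIdx d → ℝ} {K : MACIdx d}
    (hu : G.IsVelocity u) (hdiv : G.div u K = 0) (hmin : ∀ L ∈ G.cells, ρ K ≤ ρ L) :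
    G.divMass ρ u K ≤ 0 := by
  have h : G.divMass ρ u K = G.divMass ρ u K - ρ K * G.div u K := by rw [hdiv]; ring
  have hle : ∑ i, ((G.massFlux ρ u i (K + macStep i) - G.massFlux ρ u i K) -
      ρ K * (G.faceArea i (K + macStep i) * u i (K + macStep i) - G.faceArea i K * u i K)) ≤ 0 := by
    refine Finset.sum_nonpos fun i _ => ?_
    have h1 : G.massFlux ρ u i (K + macStep i) ≤
        ρ K * (G.faceArea i (K + macStep i) * u i (K + macStep i)) := by
      unfold massFlux
      have hA := G.faceArea_pos i (K + macStep i)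
      split_ifs with hs
      · rw [add_sub_cancel_right]; exact le_of_eq (by ring)
      -- A negative velocity is nonzero, so the face is interior and minimality applies to the
      -- upwind cell.
      · have hL : K + macStep i ∈ G.cells := by
          by_contra hc
          exact hs (hu.eq_zero_of_notMem hc).ge
        nlinarith [mul_nonneg (mul_nonneg hA.le (neg_nonneg.2 (not_le.1 hs).le))
          (sub_nonneg.2 (hmin _ hL))]
    have h2 : ρ K * (G.faceArea i K * u i K) ≤ G.massFlux ρ u i K := by
      unfold massFlux
      have hA := G.faceArea_pos i K
      split_ifs with hs
      · by_cases hL : K - macStep i ∈ G.cells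
        · nlinarith [mul_nonneg (mul_nonneg hA.le hs) (sub_nonneg.2 (hmin _ hL))]
        · rw [hu.eq_zero_of_sub_notMem hL]; simp
      · exact le_of_eq (by ring)
    linarith
  rw [h, divMass, div, mul_left_comm, ← mul_sub, Finset.mul_sum, ← Finset.sum_sub_distrib]
  exact mul_nonpos_of_nonneg_of_nonpos (inv_nonneg.2 (G.cellVol_pos K).le) hle

/-- The upwind side depends on the velocity alone, so the flux is odd in the density; this turns the
minimum principle into the maximum principle. -/
theorem divMass_neg (ρ : MACIdx d → ℝ) (u : Fin d → MACIdx d → ℝ) (K : MACIdx d) :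
    G.divMass (-ρ) u K = -G.divMass ρ u K := by
  have h : ∀ i L, G.massFlux (-ρ) u i L = -G.massFlux ρ u i L := by
    intro i L
    unfold massFlux
    split_ifs <;> simp
  simp only [divMass, h]
  rw [← mul_neg, ← Finset.sum_neg_distrib]
  congr 1
  exact Finset.sum_congr rfl fun i _ => by ring

/-- Discrete minimum principle for one step of the implicit upwind scheme. -/
theorem le_of_massBalance {τ : ℝ} (hτ : 0 < τ) {ρ ρ' : MACIdx d → ℝ} {u : Fin d → MACIdx d → ℝ}
    (hu : G.IsVelocity u) (hdiv : ∀ K ∈ G.cells, G.div u K = 0)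
    (hmass : ∀ K ∈ G.cells, (ρ' K - ρ K) / τ + G.divMass ρ' u K = 0) {m : ℝ}
    (hm : ∀ K ∈ G.cells, m ≤ ρ K) : ∀ K ∈ G.cells, m ≤ ρ' K := by
  intro K hK
  obtain ⟨L, hL, hmin⟩ := G.cells.exists_min_image ρ' ⟨K, hK⟩
  have h1 := G.divMass_nonpos_of_forall_le hu (hdiv L hL) hmin
  have h2 : 0 ≤ (ρ' L - ρ L) / τ := by linarith [hmass L hL]
  have h3 : 0 ≤ ρ' L - ρ L := by
    have := mul_nonneg h2 hτ.le
    rwa [div_mul_cancel₀ _ hτ.ne'] at this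
  linarith [hmin K hK, hm L hL]

theorem ge_of_massBalance {τ : ℝ} (hτ : 0 < τ) {ρ ρ' : MACIdx d → ℝ} {u : Fin d → MACIdx d → ℝ}
    (hu : G.IsVelocity u) (hdiv : ∀ K ∈ G.cells, G.div u K = 0)
    (hmass : ∀ K ∈ G.cells, (ρ' K - ρ K) / τ + G.divMass ρ' u K = 0) {m : ℝ}
    (hm : ∀ K ∈ G.cells, ρ K ≤ m) : ∀ K ∈ G.cells, ρ' K ≤ m := by
  intro K hK
  refine neg_le_neg_iff.1 (G.le_of_massBalance hτ (ρ := -ρ) (ρ' := -ρ') hu hdiv (fun L hL => ?_)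
    (fun L hL => neg_le_neg (hm L hL)) K hK)
  rw [divMass_neg]
  have := hmass L hL
  simp only [Pi.neg_apply]
  linear_combination -this

theorem dualVol_mul_dualDensity (ρ : MACIdx d → ℝ) (i : Fin d) (K : MACIdx d) :
    G.dualVol i K * G.dualDensity ρ i K =
      G.cellVol K / 2 * ρ K + G.cellVol (K - macStep i) / 2 * ρ (K - macStep i) :=
  mul_div_cancel₀ _ (G.dualVol_pos i K).ne'

theorem le_dualDensity {ρ : MACIdx d → ℝ} {m : ℝ} (hm : ∀ K ∈ G.cells, m ≤ ρ K) {i : Fin d}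
    {K : MACIdx d} (hK : K ∈ G.intFaces i) : m ≤ G.dualDensity ρ i K := by
  obtain ⟨h1, h2⟩ := G.mem_intFaces.1 hK
  rw [dualDensity, le_div_iff₀ (G.dualVol_pos i K), dualVol]
  nlinarith [mul_le_mul_of_nonneg_left (hm _ h1) (G.cellVol_pos K).le,
    mul_le_mul_of_nonneg_left (hm _ h2) (G.cellVol_pos (K - macStep i)).le]

theorem dualDensity_le {ρ : MACIdx d → ℝ} {m : ℝ} (hm : ∀ K ∈ G.cells, ρ K ≤ m) {i : Fin d}
    {K : MACIdx d} (hK : K ∈ G.intFaces i) : G.dualDensity ρ i K ≤ m := by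
  obtain ⟨h1, h2⟩ := G.mem_intFaces.1 hK
  rw [dualDensity, div_le_iff₀ (G.dualVol_pos i K), dualVol]
  nlinarith [mul_le_mul_of_nonneg_left (hm _ h1) (G.cellVol_pos K).le,
    mul_le_mul_of_nonneg_left (hm _ h2) (G.cellVol_pos (K - macStep i)).le]

theorem cellVol_mul_divMass (ρ : MACIdx d → ℝ) (u : Fin d → MACIdx d → ℝ) (K : MACIdx d) :
    G.cellVol K * G.divMass ρ u K =
      ∑ j, (G.massFlux ρ u j (K + macStep j) - G.massFlux ρ u j K) :=
  mul_inv_cancel_left₀ (G.cellVol_pos K).ne' _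

/-- The mass balance on a dual cell is half the sum of those on the two neighbouring cells. -/
theorem dual_massBalance {τ : ℝ} {ρ ρ' : MACIdx d → ℝ} {u : Fin d → MACIdx d → ℝ}
    (hmass : ∀ K ∈ G.cells, (ρ' K - ρ K) / τ + G.divMass ρ' u K = 0) {i : Fin d} {K : MACIdx d}
    (hK : K ∈ G.intFaces i) :
    G.dualVol i K * ((G.dualDensity ρ' i K - G.dualDensity ρ i K) / τ) +
      ∑ j, (G.dualMassFlux ρ' u i j (K + macStep j) - G.dualMassFlux ρ' u i j K) = 0 := by
  obtain ⟨h1, h2⟩ := G.mem_intFaces.1 hK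
  have e1 := hmass _ h1
  have e2 := hmass _ h2
  have s : ∑ j, (G.dualMassFlux ρ' u i j (K + macStep j) - G.dualMassFlux ρ' u i j K) =
      (G.cellVol K * G.divMass ρ' u K +
        G.cellVol (K - macStep i) * G.divMass ρ' u (K - macStep i)) / 2 := by
    rw [cellVol_mul_divMass, cellVol_mul_divMass, ← Finset.sum_add_distrib, Finset.sum_div]
    refine Finset.sum_congr rfl fun j _ => ?_
    rw [dualMassFlux, dualMassFlux, add_sub_right_comm]
    ring
  rw [s, mul_div_assoc', mul_sub, dualVol_mul_dualDensity, dualVol_mul_dualDensity]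
  linear_combination G.cellVol K / 2 * e1 + G.cellVol (K - macStep i) / 2 * e2

/-! ### Convection -/

/-- The expression equals `|F| (a - b)² / 2`, the numerical dissipation of the upwind choice. -/
theorem upwind_nonneg (F a b : ℝ) :
    0 ≤ F * (if 0 ≤ F then a else b) * (a - b) - F * (a ^ 2 - b ^ 2) / 2 := by
  split_ifs with h
  · nlinarith [mul_nonneg h (sq_nonneg (a - b))]
  · nlinarith [mul_nonneg (neg_nonneg.2 (not_le.1 h).le) (sq_nonneg (a - b))]

/-- The upwind convection operator dissipates kinetic energy. -/
theorem sum_sq_mul_dualMassFlux_le {ρ : MACIdx d → ℝ} {u : Fin d → MACIdx d → ℝ}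
    (hu : G.IsVelocity u) (i : Fin d) :
    ∑ K ∈ G.intFaces i, u i K ^ 2 / 2 *
        ∑ j, (G.dualMassFlux ρ u i j (K + macStep j) - G.dualMassFlux ρ u i j K) ≤
      ∑ K ∈ G.intFaces i, G.dualVol i K * G.convection ρ u i K * u i K := by
  have hz : ∀ K, K ∉ G.cells → u i K = 0 := fun K hK => hu.eq_zero_of_notMem hK
  -- Both sides are moved onto the dual faces by summation by parts, where they can be compared face
  -- by face.
  have e1 : ∑ K ∈ G.intFaces i, G.dualVol i K * G.convection ρ u i K * u i K =
      ∑ j, ∑ K ∈ G.window, G.momentumFlux ρ u i j K * (u i (K - macStep j) - u i K) := by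
    rw [sum_intFaces_eq_sum_window _ i _ fun K hK => by rw [hu i K hK, mul_zero]]
    simp only [← G.sum_window_by_parts _ (u i) _ hz]
    rw [Finset.sum_comm]
    refine Finset.sum_congr rfl fun K _ => ?_
    rw [convection, mul_inv_cancel_left₀ (G.dualVol_pos i K).ne', mul_comm, Finset.mul_sum]
  have e2 : ∑ K ∈ G.intFaces i, u i K ^ 2 / 2 *
        ∑ j, (G.dualMassFlux ρ u i j (K + macStep j) - G.dualMassFlux ρ u i j K) =
      ∑ j, ∑ K ∈ G.window,
        G.dualMassFlux ρ u i j K * (u i (K - macStep j) ^ 2 / 2 - u i K ^ 2 / 2) := by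
    rw [sum_intFaces_eq_sum_window _ i _ fun K hK => by rw [hu i K hK]; simp]
    simp only [← G.sum_window_by_parts _ (fun K => u i K ^ 2 / 2) _ fun K hK => by simp [hz K hK]]
    rw [Finset.sum_comm]
    exact Finset.sum_congr rfl fun K _ => Finset.mul_sum _ _ _
  rw [e1, e2]
  refine Finset.sum_le_sum fun j _ => Finset.sum_le_sum fun K _ => ?_
  have := upwind_nonneg (G.dualMassFlux ρ u i j K) (u i (K - macStep j)) (u i K)
  rw [momentumFlux]
  linarith

/-! ### Pressure -/

/-- The discrete gradient is minus the adjoint of the discrete divergence. -/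
theorem sum_pressureGrad {p : MACIdx d → ℝ} {u : Fin d → MACIdx d → ℝ}
    (hu : G.IsVelocity u) (hdiv : ∀ K ∈ G.cells, G.div u K = 0) :
    ∑ i, ∑ K ∈ G.intFaces i, G.dualVol i K * G.pressureGrad p i K * u i K = 0 := by
  have e : ∀ i, ∑ K ∈ G.intFaces i, G.dualVol i K * G.pressureGrad p i K * u i K =
      -∑ K ∈ G.window, p K * (G.faceArea i (K + macStep i) * u i (K + macStep i) -
        G.faceArea i K * u i K) := by
    intro i
    rw [sum_intFaces_eq_sum_window _ i _ fun K hK => by rw [hu i K hK, mul_zero]]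
    have h := G.sum_window_by_parts i (fun K => G.faceArea i K * u i K) (fun K => p (K - macStep i))
      fun K hK => by simp [hu.eq_zero_of_notMem hK]
    have h' := G.sum_window_shift (macStep i)
      (fun K => p (K - macStep i) * (G.faceArea i K * u i K)) (by
        intro K hK
        have hK' : K ∈ G.cells := by
          by_contra hc
          exact hK (by simp [hu.eq_zero_of_notMem hc])
        refine ⟨G.cells_subset_window hK', G.mem_window hK' fun k => ?_⟩
        have := macStep_mem i k
        simp only [Pi.sub_apply]
        omega)
    simp only [add_sub_cancel_right] at h'
    simp only [mul_sub, Finset.sum_sub_distrib]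
    rw [h', neg_sub, ← Finset.sum_sub_distrib]
    refine Finset.sum_congr rfl fun K _ => ?_
    rw [pressureGrad]
    have := (G.dualVol_pos i K).ne'
    field_simp
  simp only [e]
  rw [Finset.sum_neg_distrib, Finset.sum_comm, neg_eq_zero]
  refine Finset.sum_eq_zero fun K _ => ?_
  rw [← Finset.mul_sum]
  by_cases hK : K ∈ G.cells
  · have := hdiv K hK
    rw [div, mul_eq_zero] at this
    rw [this.resolve_left (inv_ne_zero (G.cellVol_pos K).ne'), mul_zero]
  -- Nothing is known about the divergence off the mesh, but there every bounding face fails to be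
  -- interior and the velocity vanishes.
  · rw [Finset.sum_eq_zero, mul_zero]
    intro i _
    rw [hu.eq_zero_of_notMem hK, hu.eq_zero_of_sub_notMem (by simpa using hK)]
    simp

end MACGrid

namespace MACGrid

variable {d : ℕ} {Ω : Set (EuclideanSpace ℝ (Fin d))} (G : MACGrid d Ω)

/-! ### Viscous dissipation and Korn's inequality -/

/-- Valid even where the quotient is `0 / 0`: the distance is zero only if `j ≠ i` and both
`i`-faces are absent, and then both values are zero. -/
theorem grad_mul_dualDist {u : Fin d → MACIdx d → ℝ} (hu : G.IsVelocity u) (i j : Fin d)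
    (K : MACIdx d) :
    G.grad u i j K * G.dualDist i j K = u i K - u i (K - macStep j) := by
  by_cases h : G.dualDist i j K = 0
  · have hw1 := G.width_pos j (K j)
    have hw2 := G.width_pos j (K j - 1)
    have hw3 := G.width_pos i (K i - 1)
    rw [h, mul_zero]
    unfold dualDist at h
    split_ifs at h with h1 h2 h3 h3
    any_goals linarith
    rw [hu.eq_zero_of_notMem_faces h2, hu.eq_zero_of_notMem_faces h3, sub_zero]
  · exact div_mul_cancel₀ _ h

/-- The measure of the dual-dual cell around a dual face. -/
noncomputable def diamondVol (i j : Fin d) (K : MACIdx d) : ℝ := G.dualArea i j K * G.dualDist i j K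

theorem diamondVol_nonneg (i j : Fin d) (K : MACIdx d) : 0 ≤ G.diamondVol i j K :=
  mul_nonneg (G.dualArea_nonneg i j K) (G.dualDist_nonneg i j K)

theorem diamondVol_of_ne {i j : Fin d} (h : i ≠ j) (K : MACIdx d) :
    G.diamondVol i j K = G.dualDist i j K * G.dualDist j i K *
      ∏ k ∈ (Finset.univ.erase i).erase j, G.width k (K k) := by
  rw [diamondVol, dualArea, if_neg h]
  ring

/-- For `i ≠ j` the extent of the dual face in direction `i` is the dual distance of the swapped
pair, so the two distances enter symmetrically. -/
theorem diamondVol_comm (i j : Fin d) (K : MACIdx d) :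
    G.diamondVol i j K = G.diamondVol j i K := by
  by_cases h : i = j
  · rw [h]
  · rw [diamondVol_of_ne _ h, diamondVol_of_ne _ (Ne.symm h), Finset.erase_right_comm]
    ring

theorem dualViscosity_comm (μ : ℝ → ℝ) (ρ : MACIdx d → ℝ) (i j : Fin d) (K : MACIdx d) :
    G.dualViscosity μ ρ i j K = G.dualViscosity μ ρ j i K := by
  by_cases h : i = j
  · rw [h]
  · have e : ({K, K - macStep i, K - macStep j, K - macStep i - macStep j} : Finset (MACIdx d)) =
        {K, K - macStep j, K - macStep i, K - macStep j - macStep i} := by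
      rw [sub_right_comm K (macStep j) (macStep i), Finset.insert_comm (K - macStep i)]
    rw [dualViscosity, dualViscosity, if_neg h, if_neg (Ne.symm h), e]

/-- Window positions that are not dual faces have zero values on both sides, so a single index set
serves all pairs `i`, `j`. -/
theorem normSq_eq {u : Fin d → MACIdx d → ℝ} (hu : G.IsVelocity u) :
    G.normSq u = ∑ i, ∑ j, ∑ K ∈ G.window, G.diamondVol i j K * G.grad u i j K ^ 2 := by
  refine Finset.sum_congr rfl fun i _ => Finset.sum_congr rfl fun j _ => ?_
  have e : ∀ K, G.dualArea i j K / G.dualDist i j K * (u i K - u i (K - macStep j)) ^ 2 =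
      G.diamondVol i j K * G.grad u i j K ^ 2 := by
    intro K
    rw [← G.grad_mul_dualDist hu, diamondVol]
    by_cases h : G.dualDist i j K = 0
    · simp [h]
    · field_simp
  simp only [← e]
  refine Finset.sum_subset (fun K hK => ?_) fun K _ hK => ?_
  · obtain ⟨L, hL, h⟩ : ∃ L ∈ G.cells, K = L ∨ (∃ k, K = L + macStep k) ∨
        ∃ k l, K = L + macStep k + macStep l := by
      unfold dualFaces faces at hK
      split_ifs at hK with hij
      · obtain ⟨L, hL, rfl⟩ := Finset.mem_image.1 hK
        exact ⟨L, hL, Or.inr (Or.inl ⟨_, rfl⟩)⟩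
      · simp only [Finset.mem_union, Finset.mem_image] at hK
        rcases hK with (hK | ⟨L, hL, rfl⟩) | ⟨L, hK | ⟨M, hM, rfl⟩, rfl⟩
        · exact ⟨K, hK, Or.inl rfl⟩
        · exact ⟨L, hL, Or.inr (Or.inl ⟨_, rfl⟩)⟩
        · exact ⟨L, hK, Or.inr (Or.inl ⟨_, rfl⟩)⟩
        · exact ⟨M, hM, Or.inr (Or.inr ⟨_, _, rfl⟩)⟩
    refine G.mem_window hL fun m => ?_
    rcases h with rfl | ⟨k, rfl⟩ | ⟨k, l, rfl⟩
    · omega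
    · have := macStep_mem k m
      simp only [Pi.add_apply]
      omega
    · have := macStep_mem k m
      have := macStep_mem l m
      simp only [Pi.add_apply]
      omega
  · have h : u i K = 0 ∧ u i (K - macStep j) = 0 := by
      unfold dualFaces at hK
      split_ifs at hK with hij
      · subst hij
        have hK' : K - macStep i ∉ G.cells := fun hc =>
          hK (Finset.mem_image.2 ⟨_, hc, by simp⟩)
        exact ⟨hu.eq_zero_of_sub_notMem hK', hu.eq_zero_of_notMem hK'⟩
      · rw [Finset.mem_union, not_or] at hK
        exact ⟨hu.eq_zero_of_notMem_faces hK.1, hu.eq_zero_of_notMem_faces fun hc =>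
          hK.2 (Finset.mem_image.2 ⟨_, hc, by simp⟩)⟩
    rw [h.1, h.2]
    simp

/-- The forward difference quotient, the contribution of direction `i` to the divergence. -/
noncomputable def fwdGrad (u : Fin d → MACIdx d → ℝ) (i : Fin d) (K : MACIdx d) : ℝ :=
  (u i (K + macStep i) - u i K) / G.width i (K i)

/-- On a cell this is the divergence, because the volume is width times face area; off the mesh each
term vanishes separately. -/
theorem sum_fwdGrad {u : Fin d → MACIdx d → ℝ} (hu : G.IsVelocity u)
    (hdiv : ∀ K ∈ G.cells, G.div u K = 0) (K : MACIdx d) : ∑ i, G.fwdGrad u i K = 0 := by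
  by_cases hK : K ∈ G.cells
  · rw [← hdiv K hK, div, Finset.mul_sum]
    refine Finset.sum_congr rfl fun i _ => ?_
    rw [fwdGrad, faceArea_add_step, ← G.width_mul_faceArea i K]
    have := (G.width_pos i (K i)).ne'
    have := (G.faceArea_pos i K).ne'
    field_simp
  · refine Finset.sum_eq_zero fun i _ => ?_
    rw [fwdGrad, hu.eq_zero_of_notMem hK, hu.eq_zero_of_sub_notMem (by simpa using hK)]
    simp

/-- Summation by parts in two directions: backward differences become forward differences. -/
theorem sum_grad_mul_grad_comm {u : Fin d → MACIdx d → ℝ} (hu : G.IsVelocity u) (i j : Fin d) :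
    ∑ K ∈ G.window, G.diamondVol i j K * (G.grad u i j K * G.grad u j i K) =
      ∑ K ∈ G.window, G.cellVol K * (G.fwdGrad u i K * G.fwdGrad u j K) := by
  have hz : ∀ (k : Fin d) K, K ∉ G.cells → u k K = 0 := fun k K hK => hu.eq_zero_of_notMem hK
  by_cases hij : i = j
  · subst hij
    have e : ∀ K, G.diamondVol i i K * (G.grad u i i K * G.grad u i i K) =
        G.faceArea i K / G.width i (K i - 1) * (u i K - u i (K - macStep i)) ^ 2 := by
      intro K
      rw [diamondVol, dualArea, grad, dualDist, if_pos rfl, if_pos rfl]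
      have := (G.width_pos i (K i - 1)).ne'
      field_simp
    simp only [e]
    -- The mid-plane with index `K` lies in the cell `K - macStep i`, so the diagonal case is a mere
    -- shift.
    rw [← G.sum_window_shift (macStep i)]
    · refine Finset.sum_congr rfl fun K _ => ?_
      rw [add_sub_cancel_right, faceArea_add_step, ← G.width_mul_faceArea i K, fwdGrad,
        Pi.add_apply, macStep_apply_self, add_sub_cancel_right]
      have := (G.width_pos i (K i)).ne'
      field_simp
    · intro K hK
      have hK' : K - macStep i ∈ G.cells := by
        by_contra hc
        exact hK (by simp [hu.eq_zero_of_sub_notMem hc, hu.eq_zero_of_notMem hc])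
      refine ⟨G.mem_window hK' fun k => ?_, G.cells_subset_window hK'⟩
      have := macStep_mem i k
      simp only [Pi.sub_apply]
      omega
  · set r : MACIdx d → ℝ := fun K => ∏ k ∈ (Finset.univ.erase i).erase j, G.width k (K k) with hr
    have hri : ∀ K, r (K + macStep i) = r K := fun K => Finset.prod_congr rfl fun k hk => by
      rw [Pi.add_apply, macStep_apply_of_ne (Finset.ne_of_mem_erase (Finset.mem_of_mem_erase hk)),
        add_zero]
    have hrj : ∀ K, r (K + macStep j) = r K := fun K => Finset.prod_congr rfl fun k hk => by
      rw [Pi.add_apply, macStep_apply_of_ne (Finset.ne_of_mem_erase hk), add_zero]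
    have hvol : ∀ K, G.cellVol K = G.width i (K i) * (G.width j (K j) * r K) := by
      intro K
      rw [cellVol, ← Finset.mul_prod_erase Finset.univ _ (Finset.mem_univ i),
        ← Finset.mul_prod_erase (Finset.univ.erase i) _
          (Finset.mem_erase.2 ⟨Ne.symm hij, Finset.mem_univ j⟩)]
    -- The two distances in the volume cancel the denominators. Only the weight `r` is left; it does
    -- not depend on the `i`- and `j`-coordinates, so both sides expand into the same four products
    -- up to shifts.
    have eL : ∀ K, G.diamondVol i j K * (G.grad u i j K * G.grad u j i K) =
        r K * u i K * u j K - r K * u i K * u j (K - macStep i)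
          - r K * u i (K - macStep j) * u j K
          + r K * u i (K - macStep j) * u j (K - macStep i) := by
      intro K
      rw [G.diamondVol_of_ne hij]
      linear_combination r K * (G.grad u j i K * G.dualDist j i K) * G.grad_mul_dualDist hu i j K +
        r K * (u i K - u i (K - macStep j)) * G.grad_mul_dualDist hu j i K
    have eR : ∀ K, G.cellVol K * (G.fwdGrad u i K * G.fwdGrad u j K) =
        r K * u i K * u j K - r K * u i (K + macStep i) * u j K
          - r K * u i K * u j (K + macStep j)
          + r K * u i (K + macStep i) * u j (K + macStep j) := by
      intro K
      rw [hvol, fwdGrad, fwdGrad]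
      have := (G.width_pos i (K i)).ne'
      have := (G.width_pos j (K j)).ne'
      field_simp
      ring
    have s1 := G.sum_window_shift (macStep i) (fun K => r K * u i K * u j (K - macStep i)) (by
      intro K hK
      have hK' : K ∈ G.cells := by
        by_contra hc
        exact hK (by simp [hz _ _ hc])
      refine ⟨G.cells_subset_window hK', G.mem_window hK' fun k => ?_⟩
      have := macStep_mem i k
      simp only [Pi.sub_apply]
      omega)
    have s2 := G.sum_window_shift (macStep j) (fun K => r K * u i (K - macStep j) * u j K) (by
      intro K hK
      have hK' : K ∈ G.cells := by
        by_contra hc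
        exact hK (by simp [hz _ _ hc])
      refine ⟨G.cells_subset_window hK', G.mem_window hK' fun k => ?_⟩
      have := macStep_mem j k
      simp only [Pi.sub_apply]
      omega)
    have s3 := G.sum_window_shift (macStep i + macStep j)
      (fun K => r K * u i (K - macStep j) * u j (K - macStep i)) (by
        intro K hK
        have hK' : K - macStep j ∈ G.cells := by
          by_contra hc
          exact hK (by simp [hz _ _ hc])
        constructor <;> refine G.mem_window hK' fun k => ?_ <;>
        · have := macStep_mem i k
          have := macStep_mem j k
          simp only [Pi.sub_apply, Pi.add_apply]
          omega)
    have a1 : ∀ K : MACIdx d, K + (macStep i + macStep j) - macStep j = K + macStep i := fun K => by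
      abel
    have a2 : ∀ K : MACIdx d, K + (macStep i + macStep j) - macStep i = K + macStep j := fun K => by
      abel
    have a3 : ∀ K : MACIdx d, K + (macStep i + macStep j) = K + macStep i + macStep j := fun K => by
      abel
    simp only [a1, a2] at s3
    simp only [a3, add_sub_cancel_right, hri, hrj] at s1 s2 s3
    simp only [eL, eR, Finset.sum_add_distrib, Finset.sum_sub_distrib]
    rw [← s1, ← s2, ← s3]

/-- Korn's identity for divergence-free discrete velocities. -/
theorem sum_sq_symGrad {u : Fin d → MACIdx d → ℝ} (hu : G.IsVelocity u)
    (hdiv : ∀ K ∈ G.cells, G.div u K = 0) :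
    ∑ i, ∑ j, ∑ K ∈ G.window,
      G.diamondVol i j K * ((G.grad u i j K + G.grad u j i K) / 2) ^ 2 = G.normSq u / 2 := by
  have cross : ∑ i, ∑ j, ∑ K ∈ G.window,
      G.diamondVol i j K * (G.grad u i j K * G.grad u j i K) = 0 := by
    simp only [G.sum_grad_mul_grad_comm hu]
    -- For fixed `i` and `K`, the sum over `j` is the divergence.
    have : ∀ i, ∑ j, ∑ K ∈ G.window, G.cellVol K * (G.fwdGrad u i K * G.fwdGrad u j K) = 0 := by
      intro i
      rw [Finset.sum_comm]
      refine Finset.sum_eq_zero fun K _ => ?_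
      rw [← Finset.mul_sum, ← Finset.mul_sum, G.sum_fwdGrad hu hdiv, mul_zero, mul_zero]
    simp [this]
  have swap : ∑ i, ∑ j, ∑ K ∈ G.window, G.diamondVol i j K * G.grad u j i K ^ 2 = G.normSq u := by
    rw [Finset.sum_comm, G.normSq_eq hu]
    refine Finset.sum_congr rfl fun i _ => Finset.sum_congr rfl fun j _ =>
      Finset.sum_congr rfl fun K _ => ?_
    rw [diamondVol_comm]
  have e : ∀ i j K, G.diamondVol i j K * ((G.grad u i j K + G.grad u j i K) / 2) ^ 2 =
      G.diamondVol i j K * G.grad u i j K ^ 2 / 4 + G.diamondVol i j K * G.grad u j i K ^ 2 / 4 +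
        G.diamondVol i j K * (G.grad u i j K * G.grad u j i K) / 2 := fun i j K => by ring
  simp only [e, Finset.sum_add_distrib, ← Finset.sum_div]
  rw [cross, swap, ← G.normSq_eq hu]
  ring

/-- A weighted mean of values above `m` is above `m`. The bound is stated with its factor because
away from the mesh the viscosity is meaningless; there the volume or the gradient vanishes. -/
theorem le_dualViscosity {μ : ℝ → ℝ} {ρ : MACIdx d → ℝ} {m : ℝ}
    (hm : ∀ K ∈ G.cells, m ≤ μ (ρ K)) {u : Fin d → MACIdx d → ℝ} (hu : G.IsVelocity u)
    (i j : Fin d) (K : MACIdx d) :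
    m * (G.diamondVol i j K * ((G.grad u i j K + G.grad u j i K) / 2) ^ 2) ≤
      G.dualViscosity μ ρ i j K *
        (G.diamondVol i j K * ((G.grad u i j K + G.grad u j i K) / 2) ^ 2) := by
  have h0 : 0 ≤ G.diamondVol i j K * ((G.grad u i j K + G.grad u j i K) / 2) ^ 2 :=
    mul_nonneg (G.diamondVol_nonneg i j K) (sq_nonneg _)
  by_cases hij : i = j
  · subst hij
    by_cases hK : K - macStep i ∈ G.cells
    · rw [dualViscosity, if_pos rfl]
      exact mul_le_mul_of_nonneg_right (hm _ hK) h0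
    · have : G.grad u i i K = 0 := by
        rw [grad, hu.eq_zero_of_sub_notMem hK, hu.eq_zero_of_notMem hK]
        simp
      simp [this]
  · rw [dualViscosity, if_neg hij]
    set s := ({K, K - macStep i, K - macStep j, K - macStep i - macStep j} :
      Finset (MACIdx d)) ∩ G.cells with hs
    rcases s.eq_empty_or_nonempty with he | hne
    · have h4 : ∀ L ∈ ({K, K - macStep i, K - macStep j, K - macStep i - macStep j} :
          Finset (MACIdx d)), L ∉ G.cells := fun L hL hc => by
        have : L ∈ s := Finset.mem_inter.2 ⟨hL, hc⟩
        simp [he] at this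
      have hd0 : G.dualDist i j K = 0 := by
        have n1 : K ∉ G.faces i := fun h => (G.mem_faces.1 h).elim (h4 _ (by simp))
          (h4 _ (by simp))
        have n2 : K - macStep j ∉ G.faces i := fun h => (G.mem_faces.1 h).elim (h4 _ (by simp))
          (h4 _ (by rw [sub_right_comm]; simp))
        rw [dualDist, if_neg hij, if_neg n1, if_neg n2, add_zero]
      simp [diamondVol, hd0]
    · refine mul_le_mul_of_nonneg_right ?_ h0
      rw [le_div_iff₀ (Finset.sum_pos (fun L _ => G.cellVol_pos L) hne), Finset.mul_sum]
      refine Finset.sum_le_sum fun L hL => ?_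
      rw [mul_comm]
      exact mul_le_mul_of_nonneg_left (hm L (Finset.mem_inter.1 hL).2) (G.cellVol_pos L).le

/-- Coercivity of the viscous term. -/
theorem mul_normSq_le_neg_sum_diffusion {μ : ℝ → ℝ} {ρ : MACIdx d → ℝ} {m : ℝ}
    (hm : ∀ K ∈ G.cells, m ≤ μ (ρ K)) {u : Fin d → MACIdx d → ℝ} (hu : G.IsVelocity u)
    (hdiv : ∀ K ∈ G.cells, G.div u K = 0) :
    m * (G.normSq u / 2) ≤
      -∑ i, ∑ K ∈ G.intFaces i, G.dualVol i K * G.diffusion μ ρ u i K * u i K := by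
  set S : Fin d → Fin d → MACIdx d → ℝ :=
    fun i j K => (G.grad u i j K + G.grad u j i K) / 2 with hS
  have hSc : ∀ i j K, S i j K = S j i K := fun i j K => by simp only [hS]; ring
  have e : ∀ i, -∑ K ∈ G.intFaces i, G.dualVol i K * G.diffusion μ ρ u i K * u i K =
      ∑ j, ∑ K ∈ G.window,
        G.dualViscosity μ ρ i j K * (G.diamondVol i j K * (S i j K * G.grad u i j K)) := by
    intro i
    have hz : ∀ K, K ∉ G.cells → u i K = 0 := fun K hK => hu.eq_zero_of_notMem hK
    have : ∑ K ∈ G.intFaces i, G.dualVol i K * G.diffusion μ ρ u i K * u i K =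
        ∑ j, ∑ K ∈ G.window, G.viscousFlux μ ρ u i j K * (u i (K - macStep j) - u i K) := by
      rw [sum_intFaces_eq_sum_window _ i _ fun K hK => by rw [hu i K hK, mul_zero]]
      simp only [← G.sum_window_by_parts _ (u i) _ hz]
      rw [Finset.sum_comm]
      refine Finset.sum_congr rfl fun K _ => ?_
      rw [diffusion, mul_inv_cancel_left₀ (G.dualVol_pos i K).ne', mul_comm, Finset.mul_sum]
    rw [this]
    simp only [← Finset.sum_neg_distrib]
    refine Finset.sum_congr rfl fun j _ => Finset.sum_congr rfl fun K _ => ?_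
    rw [viscousFlux, diamondVol]
    linear_combination (-(G.dualArea i j K * G.dualViscosity μ ρ i j K * S i j K)) *
      G.grad_mul_dualDist hu i j K
  -- Testing produces only `ð_j u_i`; volume, viscosity and `S` are symmetric, so exchanging `i` and
  -- `j` replaces it by its symmetric part.
  have sym : ∑ i, ∑ j, ∑ K ∈ G.window,
      G.dualViscosity μ ρ i j K * (G.diamondVol i j K * (S i j K * G.grad u i j K)) =
      ∑ i, ∑ j, ∑ K ∈ G.window,
        G.dualViscosity μ ρ i j K * (G.diamondVol i j K * S i j K ^ 2) := by
    have t : ∑ i, ∑ j, ∑ K ∈ G.window,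
        G.dualViscosity μ ρ i j K * (G.diamondVol i j K * (S i j K * G.grad u i j K)) =
        ∑ i, ∑ j, ∑ K ∈ G.window,
          G.dualViscosity μ ρ i j K * (G.diamondVol i j K * (S i j K * G.grad u j i K)) := by
      rw [Finset.sum_comm]
      refine Finset.sum_congr rfl fun i _ => Finset.sum_congr rfl fun j _ =>
        Finset.sum_congr rfl fun K _ => ?_
      rw [diamondVol_comm, dualViscosity_comm, hSc]
    have h : ∀ i j K, G.dualViscosity μ ρ i j K * (G.diamondVol i j K * S i j K ^ 2) =
        G.dualViscosity μ ρ i j K * (G.diamondVol i j K * (S i j K * G.grad u i j K)) / 2 +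
        G.dualViscosity μ ρ i j K * (G.diamondVol i j K * (S i j K * G.grad u j i K)) / 2 :=
      fun i j K => by simp only [hS]; ring
    simp only [h, Finset.sum_add_distrib, ← Finset.sum_div]
    rw [← t]
    ring
  rw [← Finset.sum_neg_distrib]
  simp only [e]
  rw [sym, ← G.sum_sq_symGrad hu hdiv]
  simp only [Finset.mul_sum]
  exact Finset.sum_le_sum fun i _ => Finset.sum_le_sum fun j _ => Finset.sum_le_sum fun K _ =>
    G.le_dualViscosity hm hu i j K

end MACGrid

namespace MACGrid

variable {d : ℕ} {Ω : Set (EuclideanSpace ℝ (Fin d))} (G : MACGrid d Ω)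

/-! ### Energy estimate -/

/-- The `L²` inner product of two discrete velocities. -/
noncomputable def dualInner (v w : Fin d → MACIdx d → ℝ) : ℝ :=
  ∑ i, ∑ K ∈ G.intFaces i, G.dualVol i K * v i K * w i K

/-- Twice the discrete kinetic energy. -/
noncomputable def kinetic (ρ : MACIdx d → ℝ) (v : Fin d → MACIdx d → ℝ) : ℝ :=
  ∑ i, ∑ K ∈ G.intFaces i, G.dualVol i K * (G.dualDensity ρ i K * v i K ^ 2)

theorem dualInner_self_nonneg (v : Fin d → MACIdx d → ℝ) : 0 ≤ G.dualInner v v :=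
  Finset.sum_nonneg fun i _ => Finset.sum_nonneg fun K _ => by
    rw [mul_assoc]
    exact mul_nonneg (G.dualVol_pos i K).le (mul_self_nonneg _)

theorem dualInner_le (v w : Fin d → MACIdx d → ℝ) :
    G.dualInner v w ≤ √(G.dualInner v v) * √(G.dualInner w w) := by
  have h := Real.sum_mul_le_sqrt_mul_sqrt (Finset.univ.sigma G.intFaces)
    (fun x => √(G.dualVol x.1 x.2) * v x.1 x.2) (fun x => √(G.dualVol x.1 x.2) * w x.1 x.2)
  simp only [mul_pow, Real.sq_sqrt (G.dualVol_pos _ _).le] at h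
  have e : ∀ (i : Fin d) (K : MACIdx d), √(G.dualVol i K) * v i K * (√(G.dualVol i K) * w i K) =
      G.dualVol i K * v i K * w i K := fun i K => by
    rw [mul_mul_mul_comm, Real.mul_self_sqrt (G.dualVol_pos i K).le, mul_assoc]
  simp only [Finset.sum_sigma, e, pow_two, ← mul_assoc] at h
  exact h

theorem mul_dualInner_le_kinetic {ρ : MACIdx d → ℝ} {m : ℝ} (hm : ∀ K ∈ G.cells, m ≤ ρ K)
    (v : Fin d → MACIdx d → ℝ) : m * G.dualInner v v ≤ G.kinetic ρ v := by
  simp only [dualInner, kinetic, Finset.mul_sum]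
  refine Finset.sum_le_sum fun i _ => Finset.sum_le_sum fun K hK => ?_
  have := mul_le_mul_of_nonneg_left (G.le_dualDensity hm hK)
    (mul_nonneg (G.dualVol_pos i K).le (sq_nonneg (v i K)))
  linarith

theorem kinetic_le_mul_dualInner {ρ : MACIdx d → ℝ} {m : ℝ} (hm : ∀ K ∈ G.cells, ρ K ≤ m)
    (v : Fin d → MACIdx d → ℝ) : G.kinetic ρ v ≤ m * G.dualInner v v := by
  simp only [dualInner, kinetic, Finset.mul_sum]
  refine Finset.sum_le_sum fun i _ => Finset.sum_le_sum fun K hK => ?_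
  have := mul_le_mul_of_nonneg_left (G.dualDensity_le hm hK)
    (mul_nonneg (G.dualVol_pos i K).le (sq_nonneg (v i K)))
  linarith

/-- Energy balance for one time step. -/
theorem kinetic_step {τ : ℝ} (hτ : 0 < τ) {μ : ℝ → ℝ} {m : ℝ} {ρ ρ' p : MACIdx d → ℝ}
    {u u' g : Fin d → MACIdx d → ℝ} (hρ : ∀ K ∈ G.cells, 0 ≤ ρ K)
    (hm : ∀ K ∈ G.cells, m ≤ μ (ρ' K)) (hu : G.IsVelocity u')
    (hmass : ∀ K ∈ G.cells, (ρ' K - ρ K) / τ + G.divMass ρ' u' K = 0)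
    (hmom : ∀ i, ∀ K ∈ G.intFaces i,
      (G.dualDensity ρ' i K * u' i K - G.dualDensity ρ i K * u i K) / τ
        + G.convection ρ' u' i K - G.diffusion μ ρ' u' i K + G.pressureGrad p i K = g i K)
    (hdiv : ∀ K ∈ G.cells, G.div u' K = 0) :
    G.kinetic ρ' u' + m * (τ * G.normSq u') ≤ G.kinetic ρ u + 2 * (τ * G.dualInner g u') := by
  -- The dual mass balance trades the divergence of the mass flux for the time difference of the
  -- dual density.
  have hc : ∀ i, ∑ K ∈ G.intFaces i, -(G.dualVol i K *
        ((G.dualDensity ρ' i K - G.dualDensity ρ i K) / τ * (u' i K ^ 2 / 2))) ≤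
      ∑ K ∈ G.intFaces i, G.dualVol i K * G.convection ρ' u' i K * u' i K := by
    intro i
    refine le_trans (le_of_eq ?_) (G.sum_sq_mul_dualMassFlux_le hu i)
    refine Finset.sum_congr rfl fun K hK => ?_
    linear_combination (-(u' i K ^ 2 / 2)) * G.dual_massBalance hmass hK
  have hc' := Finset.sum_le_sum fun i (_ : i ∈ Finset.univ) => hc i
  have hp := G.sum_pressureGrad (p := p) hu hdiv
  have hd := G.mul_normSq_le_neg_sum_diffusion hm hu hdiv
  have hg : G.dualInner g u' =
      ∑ i, ∑ K ∈ G.intFaces i, G.dualVol i K *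
        ((G.dualDensity ρ' i K * u' i K - G.dualDensity ρ i K * u i K) / τ * u' i K) +
      ∑ i, ∑ K ∈ G.intFaces i, G.dualVol i K * G.convection ρ' u' i K * u' i K -
      ∑ i, ∑ K ∈ G.intFaces i, G.dualVol i K * G.diffusion μ ρ' u' i K * u' i K +
      ∑ i, ∑ K ∈ G.intFaces i, G.dualVol i K * G.pressureGrad p i K * u' i K := by
    simp only [dualInner, ← Finset.sum_add_distrib, ← Finset.sum_sub_distrib]
    refine Finset.sum_congr rfl fun i _ => Finset.sum_congr rfl fun K hK => ?_
    rw [← hmom i K hK]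
    ring
  -- From `ρ'u'² - ρuu' - (ρ' - ρ)u'²/2 = ρ'u'²/2 - ρu²/2 + ρ(u' - u)²/2`; the last square is
  -- discarded, which needs `ρ ≥ 0`.
  have ht : (G.kinetic ρ' u' - G.kinetic ρ u) / (2 * τ) ≤
      ∑ i, ∑ K ∈ G.intFaces i, G.dualVol i K *
        ((G.dualDensity ρ' i K * u' i K - G.dualDensity ρ i K * u i K) / τ * u' i K) +
      ∑ i, ∑ K ∈ G.intFaces i, -(G.dualVol i K *
        ((G.dualDensity ρ' i K - G.dualDensity ρ i K) / τ * (u' i K ^ 2 / 2))) := by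
    simp only [kinetic, ← Finset.sum_add_distrib, ← Finset.sum_sub_distrib, Finset.sum_div]
    refine Finset.sum_le_sum fun i _ => Finset.sum_le_sum fun K hK => ?_
    rw [← sub_nonneg]
    have : 0 ≤ G.dualVol i K * (G.dualDensity ρ i K * (u' i K - u i K) ^ 2) / (2 * τ) :=
      div_nonneg (mul_nonneg (G.dualVol_pos i K).le
        (mul_nonneg (G.le_dualDensity hρ hK) (sq_nonneg _))) (by positivity)
    refine this.trans_eq ?_
    field_simp
    ring
  have h : (G.kinetic ρ' u' - G.kinetic ρ u) / (2 * τ) + m * (G.normSq u' / 2) ≤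
      G.dualInner g u' := by
    linarith
  rw [← le_sub_iff_add_le, div_le_iff₀ (by positivity)] at h
  linarith

theorem normSq_nonneg (u : Fin d → MACIdx d → ℝ) : 0 ≤ G.normSq u :=
  Finset.sum_nonneg fun i _ => Finset.sum_nonneg fun j _ => Finset.sum_nonneg fun K _ =>
    mul_nonneg (div_nonneg (G.dualArea_nonneg i j K) (G.dualDist_nonneg i j K)) (sq_nonneg _)

variable {G}

/-- The maximum principle for the density. -/
theorem IsDiscreteSolution.density_mem {τ : ℝ} (hτ : 0 < τ) {N : ℕ} {μ : ℝ → ℝ}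
    {ρ₀ : EuclideanSpace ℝ (Fin d) → ℝ}
    {u₀ : EuclideanSpace ℝ (Fin d) → EuclideanSpace ℝ (Fin d)} {g : ℕ → Fin d → MACIdx d → ℝ}
    {ρ : ℕ → MACIdx d → ℝ} {u : ℕ → Fin d → MACIdx d → ℝ} {p : ℕ → MACIdx d → ℝ}
    (h : G.IsDiscreteSolution τ N μ ρ₀ u₀ g ρ u p) {a b : ℝ}
    (h0 : ∀ K ∈ G.cells, G.projCell ρ₀ K ∈ Icc a b) :
    ∀ n ≤ N, ∀ K ∈ G.cells, ρ n K ∈ Icc a b := by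
  intro n
  induction n with
  | zero => exact fun _ K hK => h.density_zero K hK ▸ h0 K hK
  | succ n ih =>
    intro hn K hK
    have ih := ih (by omega)
    exact ⟨G.le_of_massBalance hτ (h.velocity_mem n hn) (h.incompressible n hn) (h.mass n hn)
        (fun L hL => (ih L hL).1) K hK,
      G.ge_of_massBalance hτ (h.velocity_mem n hn) (h.incompressible n hn) (h.mass n hn)
        (fun L hL => (ih L hL).2) K hK⟩

/-- The summed energy estimate. -/
theorem IsDiscreteSolution.energy_le {τ : ℝ} (hτ : 0 < τ) {N : ℕ} {μ : ℝ → ℝ}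
    {ρ₀ : EuclideanSpace ℝ (Fin d) → ℝ}
    {u₀ : EuclideanSpace ℝ (Fin d) → EuclideanSpace ℝ (Fin d)} {g : ℕ → Fin d → MACIdx d → ℝ}
    {ρ : ℕ → MACIdx d → ℝ} {u : ℕ → Fin d → MACIdx d → ℝ} {p : ℕ → MACIdx d → ℝ}
    (h : G.IsDiscreteSolution τ N μ ρ₀ u₀ g ρ u p) {a b m : ℝ} (ha : 0 ≤ a)
    (h0 : ∀ K ∈ G.cells, G.projCell ρ₀ K ∈ Icc a b) (hm : ∀ r ∈ Icc a b, m ≤ μ r) :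
    ∀ n ≤ N, a * √(G.dualInner (u n) (u n)) ^ 2 +
        m * ∑ k ∈ Finset.range n, τ * G.normSq (u (k + 1)) ≤
      b * G.dualInner (G.projVelocity u₀) (G.projVelocity u₀) +
        2 * ∑ k ∈ Finset.range n, τ * √(G.dualInner (g k) (g k)) *
          √(G.dualInner (u (k + 1)) (u (k + 1))) := by
  have hb := h.density_mem hτ h0
  -- The induction keeps the kinetic energy with its density, which telescopes; the lower density
  -- bound is inserted only at the end.
  have hk : ∀ n ≤ N, G.kinetic (ρ n) (u n) +
        m * ∑ k ∈ Finset.range n, τ * G.normSq (u (k + 1)) ≤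
      b * G.dualInner (G.projVelocity u₀) (G.projVelocity u₀) +
        2 * ∑ k ∈ Finset.range n, τ * √(G.dualInner (g k) (g k)) *
          √(G.dualInner (u (k + 1)) (u (k + 1))) := by
    intro n
    induction n with
    | zero =>
      intro hn
      rw [← h.velocity_zero]
      simpa using G.kinetic_le_mul_dualInner (fun K hK => (hb 0 hn K hK).2) (u 0)
    | succ n ih =>
      intro hn
      have := G.kinetic_step hτ (fun K hK => ha.trans (hb n (by omega) K hK).1)
        (fun K hK => hm _ (hb (n + 1) hn K hK)) (h.velocity_mem n hn) (h.mass n hn)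
        (h.momentum n hn) (h.incompressible n hn)
      have h2 := mul_le_mul_of_nonneg_left (G.dualInner_le (g n) (u (n + 1))) hτ.le
      have h3 := ih (by omega)
      rw [Finset.sum_range_succ, Finset.sum_range_succ]
      linarith
  intro n hn
  rw [Real.sq_sqrt (G.dualInner_self_nonneg _)]
  linarith [hk n hn, G.mul_dualInner_le_kinetic (fun K hK => (hb n hn K hK).1) (u n)]

end MACGrid

/-! ### Absorption of the source term -/

/-- A Grönwall-type argument without exponential growth: a quadratic quantity is controlled through
its maximum when the right-hand side is linear in it. -/
theorem le_of_sq_add_sum_le {α m A B : ℝ} (hα : 0 < α) (hm : 0 < m) {N : ℕ}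
    {a b s : ℕ → ℝ} (ha : ∀ n, 0 ≤ a n) (hb : ∀ n, 0 ≤ b n) (hs : ∀ n, 0 ≤ s n)
    (hB : ∑ k ∈ Finset.range N, b k ≤ B)
    (h : ∀ n ≤ N, α * a n ^ 2 + m * ∑ k ∈ Finset.range n, s k ≤
      A + 2 * ∑ k ∈ Finset.range n, b k * a (k + 1)) :
    ∑ k ∈ Finset.range N, s k ≤ (A + 2 * B * √(2 * (A + 2 * B ^ 2 / α) / α)) / m ∧
      ∀ n < N, a (n + 1) ≤ √(2 * (A + 2 * B ^ 2 / α) / α) := by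
  have key : ∀ R, (∀ n < N, a (n + 1) ≤ R) → 0 ≤ R → ∀ n ≤ N,
      ∑ k ∈ Finset.range n, b k * a (k + 1) ≤ B * R := by
    intro R hR hR0 n hn
    calc ∑ k ∈ Finset.range n, b k * a (k + 1) ≤ ∑ k ∈ Finset.range n, b k * R :=
          Finset.sum_le_sum fun k hk => mul_le_mul_of_nonneg_left
            (hR k (by have := Finset.mem_range.1 hk; omega)) (hb k)
      _ = (∑ k ∈ Finset.range n, b k) * R := (Finset.sum_mul _ _ _).symm
      _ ≤ B * R := mul_le_mul_of_nonneg_right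
          ((Finset.sum_le_sum_of_subset_of_nonneg (Finset.range_mono hn)
            fun k _ _ => hb k).trans hB) hR0
  have hbound : ∀ n < N, a (n + 1) ≤ √(2 * (A + 2 * B ^ 2 / α) / α) := by
    intro n hn
    -- At the index of the maximum, the right-hand side is at most `A` plus `2 B` times that
    -- maximum.
    obtain ⟨l, hl, hmax⟩ := (Finset.range N).exists_max_image (fun k => a (k + 1))
      ⟨n, Finset.mem_range.2 hn⟩
    have hl' := Finset.mem_range.1 hl
    refine (hmax n (Finset.mem_range.2 hn)).trans (Real.le_sqrt_of_sq_le ?_)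
    have h1 := h (l + 1) hl'
    have h2 := key _ (fun k hk => hmax k (Finset.mem_range.2 hk)) (ha _) (l + 1) hl'
    have h3 := mul_nonneg hm.le (Finset.sum_nonneg fun k (_ : k ∈ Finset.range (l + 1)) => hs k)
    rw [le_div_iff₀ hα]
    -- Young's inequality, with weights chosen to absorb half of the quadratic term.
    have h4 : 2 * (B * a (l + 1)) ≤ α * a (l + 1) ^ 2 / 2 + 2 * B ^ 2 / α := by
      have : 0 ≤ (α * a (l + 1) - 2 * B) ^ 2 / (2 * α) := by positivity
      have e : (α * a (l + 1) - 2 * B) ^ 2 / (2 * α) =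
          α * a (l + 1) ^ 2 / 2 + 2 * B ^ 2 / α - 2 * (B * a (l + 1)) := by
        field_simp
        ring
      linarith
    linarith
  refine ⟨?_, hbound⟩
  rw [le_div_iff₀ hm]
  have h1 := h N le_rfl
  have h2 := key _ hbound (Real.sqrt_nonneg _) N le_rfl
  have h3 := mul_nonneg hα.le (sq_nonneg (a N))
  linarith

/-! ### Boxes -/

/-- A closed box with edges parallel to the axes. -/
def closedBox {d : ℕ} (a b : Fin d → ℝ) : Set (EuclideanSpace ℝ (Fin d)) :=
  {x | ∀ i, x i ∈ Icc (a i) (b i)}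

/-- An open box with edges parallel to the axes. -/
def openBox {d : ℕ} (a b : Fin d → ℝ) : Set (EuclideanSpace ℝ (Fin d)) :=
  {x | ∀ i, x i ∈ Ioo (a i) (b i)}

theorem isOpen_openBox {d : ℕ} (a b : Fin d → ℝ) : IsOpen (openBox a b) := by
  have : openBox a b = ⋂ i, (fun x : EuclideanSpace ℝ (Fin d) => x i) ⁻¹' Ioo (a i) (b i) := by
    ext x; simp [openBox]
  rw [this]
  exact isOpen_iInter_of_finite fun i => isOpen_Ioo.preimage (by fun_prop)

theorem closedBox_eq_preimage {d : ℕ} (a b : Fin d → ℝ) :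
    closedBox a b = (WithLp.ofLp : EuclideanSpace ℝ (Fin d) → Fin d → ℝ) ⁻¹' Icc a b := by
  ext x
  simp [closedBox, Pi.le_def, forall_and]

/-- Open boxes are the ones contained in `Ω` and pairwise disjoint, while averages are taken over
closed ones; this passes between the two. -/
theorem openBox_ae_eq_closedBox {d : ℕ} (a b : Fin d → ℝ) : openBox a b =ᵐ[volume] closedBox a b := by
  have h : openBox a b = (WithLp.ofLp : EuclideanSpace ℝ (Fin d) → Fin d → ℝ) ⁻¹'
      (univ.pi fun i => Ioo (a i) (b i)) := by
    ext x
    simp [openBox]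
  rw [closedBox_eq_preimage, h]
  exact (PiLp.volume_preserving_ofLp (Fin d)).quasiMeasurePreserving.preimage_ae_eq
    Measure.univ_pi_Ioo_ae_eq_Icc

theorem volume_closedBox {d : ℕ} (a b : Fin d → ℝ) :
    volume (closedBox a b) = ∏ i, ENNReal.ofReal (b i - a i) := by
  rw [closedBox_eq_preimage, (PiLp.volume_preserving_ofLp (Fin d)).measure_preimage
    measurableSet_Icc.nullMeasurableSet, Real.volume_Icc_pi]

theorem volume_real_closedBox {d : ℕ} {a b : Fin d → ℝ} (h : ∀ i, a i ≤ b i) :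
    volume.real (closedBox a b) = ∏ i, (b i - a i) := by
  rw [measureReal_def, volume_closedBox, ENNReal.toReal_prod]
  exact Finset.prod_congr rfl fun i _ => ENNReal.toReal_ofReal (sub_nonneg.2 (h i))

theorem volume_closedBox_ne_top {d : ℕ} (a b : Fin d → ℝ) : volume (closedBox a b) ≠ ⊤ := by
  rw [volume_closedBox]
  exact ENNReal.prod_ne_top fun i _ => ENNReal.ofReal_ne_top

/-- The Cauchy-Schwarz inequality against the constant function. -/
theorem sq_integral_le {α : Type*} [MeasurableSpace α] {ν : Measure α} [IsFiniteMeasure ν]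
    {f : α → ℝ} (hf : MemLp f 2 ν) : (∫ x, f x ∂ν) ^ 2 ≤ ν.real univ * ∫ x, f x ^ 2 ∂ν := by
  have h1 : Integrable f ν := hf.integrable (by norm_num)
  have h2 : Integrable (fun x => f x ^ 2) ν := hf.integrable_sq
  set c := ν.real univ with hc
  set I := ∫ x, f x ∂ν with hI
  have hc0 : 0 ≤ c := measureReal_nonneg
  rcases hc0.eq_or_lt with h0 | h0
  · have : ν = 0 := by
      rw [← Measure.measure_univ_eq_zero, ← measureReal_eq_zero_iff]
      exact h0.symm
    simp [hI, this]
  -- The variance, scaled to avoid division by the total mass.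
  · have e : ∫ x, (c * f x - I) ^ 2 ∂ν = c * (c * ∫ x, f x ^ 2 ∂ν - I ^ 2) := by
      have : ∀ x, (c * f x - I) ^ 2 = c ^ 2 * f x ^ 2 - 2 * c * I * f x + I ^ 2 := fun x => by ring
      simp only [this]
      have hd : Integrable (fun x => c ^ 2 * f x ^ 2 - 2 * c * I * f x) ν :=
        (h2.const_mul _).sub (h1.const_mul _)
      rw [integral_add hd (integrable_const _),
        integral_sub (h2.const_mul _) (h1.const_mul _), integral_const_mul, integral_const_mul,
        integral_const, ← hI, ← hc, smul_eq_mul]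
      ring
    have : 0 ≤ ∫ x, (c * f x - I) ^ 2 ∂ν := integral_nonneg fun x => sq_nonneg _
    rw [e] at this
    linarith [(mul_nonneg_iff_of_pos_left h0).1 this]

namespace MACGrid

variable {d : ℕ} {Ω : Set (EuclideanSpace ℝ (Fin d))} (G : MACGrid d Ω)

/-! ### Measure of the primal and dual cells -/

/-- `Ω` is the interior of the union of the cells, hence contains every open subset of that union.
-/
theorem openBox_subset {a b : Fin d → ℝ} (h : openBox a b ⊆ ⋃ K ∈ G.cells, G.cell K) :
    openBox a b ⊆ Ω := by
  rw [G.domain_eq]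
  exact interior_maximal h (isOpen_openBox a b)

/-- The interior of the primal cell `K`. -/
def openCell (K : MACIdx d) : Set (EuclideanSpace ℝ (Fin d)) :=
  openBox (fun i => G.node i (K i)) (fun i => G.node i (K i + 1))

theorem openCell_ae_eq (K : MACIdx d) : G.openCell K =ᵐ[volume] G.cell K :=
  openBox_ae_eq_closedBox _ _

theorem openCell_subset {K : MACIdx d} (hK : K ∈ G.cells) : G.openCell K ⊆ Ω :=
  G.openBox_subset fun _ hx => mem_biUnion hK fun i => Ioo_subset_Icc_self (hx i)

theorem volume_real_cell (K : MACIdx d) : volume.real (G.cell K) = G.cellVol K :=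
  volume_real_closedBox fun i => (G.node_strictMono i (by omega : K i < K i + 1)).le

theorem volume_cell_ne_top (K : MACIdx d) : volume (G.cell K) ≠ ⊤ := volume_closedBox_ne_top _ _

/-- Lower corner of a dual cell. -/
noncomputable def dualLower (i : Fin d) (K : MACIdx d) (k : Fin d) : ℝ :=
  if k = i then G.mid i (K i - 1) else G.node k (K k)

/-- Upper corner of a dual cell. -/
noncomputable def dualUpper (i : Fin d) (K : MACIdx d) (k : Fin d) : ℝ :=
  if k = i then G.mid i (K i) else G.node k (K k + 1)

/-- The interior of the dual cell of the face `(i, K)`. -/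
def openDualCell (i : Fin d) (K : MACIdx d) : Set (EuclideanSpace ℝ (Fin d)) :=
  openBox (G.dualLower i K) (G.dualUpper i K)

theorem dualCell_eq (i : Fin d) (K : MACIdx d) :
    G.dualCell i K = closedBox (G.dualLower i K) (G.dualUpper i K) := by
  ext x
  constructor
  · intro h k
    by_cases hk : k = i
    · subst hk; simpa [dualLower, dualUpper] using h.1
    · simpa [dualLower, dualUpper, hk] using h.2 k hk
  · intro h
    exact ⟨by simpa [dualLower, dualUpper] using h i, fun k hk => by
      simpa [dualLower, dualUpper, hk] using h k⟩

theorem openDualCell_ae_eq (i : Fin d) (K : MACIdx d) :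
    G.openDualCell i K =ᵐ[volume] G.dualCell i K := by
  rw [dualCell_eq]
  exact openBox_ae_eq_closedBox _ _

theorem measurableSet_openDualCell (i : Fin d) (K : MACIdx d) :
    MeasurableSet (G.openDualCell i K) := (isOpen_openBox _ _).measurableSet

theorem volume_dualCell_ne_top (i : Fin d) (K : MACIdx d) : volume (G.dualCell i K) ≠ ⊤ := by
  rw [dualCell_eq]
  exact volume_closedBox_ne_top _ _

theorem dualUpper_sub_dualLower_self (i : Fin d) (K : MACIdx d) :
    G.dualUpper i K i - G.dualLower i K i = (G.width i (K i) + G.width i (K i - 1)) / 2 := by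
  simp only [dualUpper, dualLower, if_true, mid, width, sub_add_cancel]
  ring

theorem dualUpper_sub_dualLower_of_ne {i k : Fin d} (hk : k ≠ i) (K : MACIdx d) :
    G.dualUpper i K k - G.dualLower i K k = G.width k (K k) := by
  simp [dualUpper, dualLower, width, hk]

theorem volume_real_dualCell (i : Fin d) (K : MACIdx d) :
    volume.real (G.dualCell i K) = G.dualVol i K := by
  rw [dualCell_eq, volume_real_closedBox, ← Finset.mul_prod_erase _ _ (Finset.mem_univ i),
    dualUpper_sub_dualLower_self, Finset.prod_congr rfl fun k hk =>
      G.dualUpper_sub_dualLower_of_ne (Finset.ne_of_mem_erase hk) K, dualVol,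
    ← G.width_mul_faceArea i K, ← G.width_mul_faceArea i (K - macStep i),
    ← G.faceArea_add_step i (K - macStep i), sub_add_cancel, Pi.sub_apply, macStep_apply_self]
  · simp only [faceArea]
    ring
  · intro k
    rw [← sub_nonneg]
    by_cases hk : k = i
    · subst hk
      have := G.width_pos k (K k)
      have := G.width_pos k (K k - 1)
      rw [dualUpper_sub_dualLower_self]
      positivity
    · rw [dualUpper_sub_dualLower_of_ne _ hk]
      exact (G.width_pos k _).le

theorem openDualCell_subset {i : Fin d} {K : MACIdx d} (hK : K ∈ G.intFaces i) :
    G.openDualCell i K ⊆ Ω := by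
  refine G.openBox_subset fun x hx => ?_
  obtain ⟨h1, h2⟩ := G.mem_intFaces.1 hK
  have hi := hx i
  have ho : ∀ k, k ≠ i → x k ∈ Icc (G.node k (K k)) (G.node k (K k + 1)) := fun k hk => by
    have := hx k
    simp only [dualLower, dualUpper, if_neg hk] at this
    exact Ioo_subset_Icc_self this
  simp only [dualLower, dualUpper, if_true, mid, sub_add_cancel] at hi
  have w1 := G.width_pos i (K i)
  have w2 := G.width_pos i (K i - 1)
  simp only [width, sub_add_cancel] at w1 w2
  -- The face itself splits the dual cell into halves, one in each neighbouring cell.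
  rcases le_total (x i) (G.node i (K i)) with h | h
  · refine mem_biUnion h2 fun k => ?_
    by_cases hk : k = i
    · subst hk
      rw [Pi.sub_apply, macStep_apply_self, sub_add_cancel]
      exact ⟨by linarith [hi.1], h⟩
    · rw [Pi.sub_apply, macStep_apply_of_ne hk, sub_zero]
      exact ho k hk
  · refine mem_biUnion h1 fun k => ?_
    by_cases hk : k = i
    · subst hk
      exact ⟨h, by linarith [hi.2]⟩
    · exact ho k hk

theorem mid_mono (i : Fin d) : Monotone (G.mid i) := fun k l h => by
  have h1 := (G.node_strictMono i).monotone h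
  have h2 := (G.node_strictMono i).monotone (by omega : k + 1 ≤ l + 1)
  simp only [mid]
  linarith

theorem disjoint_openDualCell (i : Fin d) {K L : MACIdx d} (h : K ≠ L) :
    Disjoint (G.openDualCell i K) (G.openDualCell i L) := by
  obtain ⟨k, hk⟩ := Function.ne_iff.1 h
  have key : ∀ {K L : MACIdx d}, K k < L k → G.dualUpper i K k ≤ G.dualLower i L k := by
    intro K L hKL
    unfold dualUpper dualLower
    split_ifs with hki
    · subst hki; exact G.mid_mono _ (by omega)
    · exact (G.node_strictMono k).monotone (by omega)
  rw [Set.disjoint_left]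
  intro x hxK hxL
  have h1 := hxK k
  have h2 := hxL k
  rcases lt_or_gt_of_ne hk with hlt | hlt
  · linarith [key hlt, h1.2, h2.1]
  · linarith [key hlt, h2.2, h1.1]

/-! ### Projections -/

theorem projCell_mem {ρ₀ : EuclideanSpace ℝ (Fin d) → ℝ} {a b : ℝ}
    (hmeas : AEStronglyMeasurable ρ₀ (volume.restrict Ω))
    (h : ∀ᵐ x ∂(volume.restrict Ω), a ≤ ρ₀ x ∧ ρ₀ x ≤ b) {K : MACIdx d} (hK : K ∈ G.cells) :
    G.projCell ρ₀ K ∈ Icc a b := by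
  have hle : volume.restrict (G.cell K) ≤ volume.restrict Ω := by
    rw [← Measure.restrict_congr_set (G.openCell_ae_eq K)]
    exact Measure.restrict_mono_set _ (G.openCell_subset hK)
  have h' : ∀ᵐ x ∂(volume.restrict (G.cell K)), ρ₀ x ∈ Icc a b := ae_mono hle h
  have : IsFiniteMeasure (volume.restrict (G.cell K)) :=
    ⟨by simpa using (G.volume_cell_ne_top K).lt_top⟩
  refine (convex_Icc a b).set_average_mem isClosed_Icc (fun h0 => ?_) (G.volume_cell_ne_top K) h' ?_
  · have := G.cellVol_pos K
    rw [← G.volume_real_cell, measureReal_def, h0] at this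
    simp at this
  · refine Integrable.of_bound (hmeas.mono_measure hle) (max |a| |b|) ?_
    filter_upwards [h'] with x hx
    exact abs_le_max_abs_abs hx.1 hx.2

theorem restrict_dualCell_le {i : Fin d} {K : MACIdx d} (hK : K ∈ G.intFaces i) :
    volume.restrict (G.dualCell i K) ≤ volume.restrict Ω := by
  rw [← Measure.restrict_congr_set (G.openDualCell_ae_eq i K)]
  exact Measure.restrict_mono_set _ (G.openDualCell_subset hK)

theorem memLp_coord {ν : Measure (EuclideanSpace ℝ (Fin d))}
    {v : EuclideanSpace ℝ (Fin d) → EuclideanSpace ℝ (Fin d)} (hv : MemLp v 2 ν) (i : Fin d) :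
    MemLp (fun x => v x i) 2 ν :=
  (EuclideanSpace.proj i : EuclideanSpace ℝ (Fin d) →L[ℝ] ℝ).comp_memLp' hv

theorem dualVol_mul_sq_projVelocity_le {v : EuclideanSpace ℝ (Fin d) → EuclideanSpace ℝ (Fin d)}
    (hv : MemLp v 2 (volume.restrict Ω)) {i : Fin d} {K : MACIdx d} (hK : K ∈ G.intFaces i) :
    G.dualVol i K * G.projVelocity v i K ^ 2 ≤ ∫ x in G.openDualCell i K, v x i ^ 2 := by
  have : IsFiniteMeasure (volume.restrict (G.dualCell i K)) :=
    ⟨by simpa using (G.volume_dualCell_ne_top i K).lt_top⟩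
  have h := sq_integral_le (memLp_coord (hv.mono_measure (G.restrict_dualCell_le hK)) i)
  rw [measureReal_restrict_apply_univ, volume_real_dualCell] at h
  rw [setIntegral_congr_set (G.openDualCell_ae_eq i K), projVelocity, if_pos hK, setAverage_eq,
    volume_real_dualCell, smul_eq_mul]
  have hV := G.dualVol_pos i K
  rw [mul_pow, ← mul_assoc, show G.dualVol i K * (G.dualVol i K)⁻¹ ^ 2 = (G.dualVol i K)⁻¹ by
    field_simp, inv_mul_le_iff₀ hV]
  exact h

/-- Cauchy-Schwarz on each dual cell. For a fixed component the open dual cells are disjoint in `Ω`;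
the part of `Ω` they may miss, near exterior faces, only helps. -/
theorem dualInner_projVelocity_le {v : EuclideanSpace ℝ (Fin d) → EuclideanSpace ℝ (Fin d)}
    (hv : MemLp v 2 (volume.restrict Ω)) :
    G.dualInner (G.projVelocity v) (G.projVelocity v) ≤ ∫ x in Ω, ‖v x‖ ^ 2 := by
  have hi : ∀ i, Integrable (fun x => v x i ^ 2) (volume.restrict Ω) := fun i =>
    (memLp_coord hv i).integrable_sq
  simp only [EuclideanSpace.real_norm_sq_eq]
  rw [integral_finsetSum _ fun i _ => hi i]
  refine Finset.sum_le_sum fun i _ => ?_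
  have hsub : (⋃ K ∈ G.intFaces i, G.openDualCell i K) ⊆ Ω :=
    iUnion₂_subset fun K hK => G.openDualCell_subset hK
  have hU : ∫ x in ⋃ K ∈ G.intFaces i, G.openDualCell i K, v x i ^ 2 =
      ∑ K ∈ G.intFaces i, ∫ x in G.openDualCell i K, v x i ^ 2 :=
    integral_biUnion_finset _ (fun K _ => G.measurableSet_openDualCell i K)
      (fun K _ L _ h => G.disjoint_openDualCell i h)
      fun K hK => IntegrableOn.mono_set (hi i) (G.openDualCell_subset hK)
  have hle : ∫ x in ⋃ K ∈ G.intFaces i, G.openDualCell i K, v x i ^ 2 ≤ ∫ x in Ω, v x i ^ 2 :=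
    setIntegral_mono_set (hi i) (ae_of_all _ fun x => sq_nonneg _) hsub.eventuallyLE
  refine le_trans (Finset.sum_le_sum fun K hK => ?_) (hU.symm.trans_le hle)
  rw [mul_assoc, ← pow_two]
  exact G.dualVol_mul_sq_projVelocity_le hv hK

/-- The `L²` norm of a discrete velocity field in terms of its degrees of freedom. -/
theorem eLpNorm_velocityField_le (u : Fin d → MACIdx d → ℝ) :
    eLpNorm (G.velocityField u) 2 (volume.restrict Ω) ≤
      ENNReal.ofReal √(G.dualInner u u) := by
  set h : EuclideanSpace ℝ (Fin d) → ℝ := fun x =>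
    ∑ i, ∑ K ∈ G.intFaces i, (G.openDualCell i K).indicator (fun _ => u i K ^ 2) x with hh
  have hvol : ∀ i K, volume (G.openDualCell i K) ≠ ⊤ := fun i K => by
    rw [measure_congr (G.openDualCell_ae_eq i K)]
    exact G.volume_dualCell_ne_top i K
  have hind : ∀ i K, Integrable ((G.openDualCell i K).indicator fun _ => u i K ^ 2) volume :=
    fun i K => (integrable_indicator_iff (G.measurableSet_openDualCell i K)).2
      (integrableOn_const (hvol i K))
  have hint : Integrable h volume :=
    integrable_finsetSum _ fun i _ => integrable_finsetSum _ fun K _ => hind i K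
  have hval : ∫ x, h x = G.dualInner u u := by
    rw [integral_finsetSum _ fun i _ => integrable_finsetSum _ fun K _ => hind i K]
    refine Finset.sum_congr rfl fun i _ => ?_
    rw [integral_finsetSum _ fun K _ => hind i K]
    refine Finset.sum_congr rfl fun K _ => ?_
    rw [integral_indicator (G.measurableSet_openDualCell i K), setIntegral_const,
      measureReal_congr (G.openDualCell_ae_eq i K), volume_real_dualCell, smul_eq_mul]
    ring
  -- Closed dual cells overlap on their boundaries. Off this null set at most one indicator per
  -- component is nonzero, so the square of the sum is the sum of the squares.
  have hae : ∀ᵐ x ∂(volume : Measure (EuclideanSpace ℝ (Fin d))),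
      ‖G.velocityField u x‖ ^ 2 = h x := by
    have : ∀ᵐ x ∂(volume : Measure (EuclideanSpace ℝ (Fin d))),
        ∀ i K, (x ∈ G.openDualCell i K ↔ x ∈ G.dualCell i K) := by
      rw [ae_all_iff]
      intro i
      rw [ae_all_iff]
      exact fun K => (G.openDualCell_ae_eq i K).mem_iff
    filter_upwards [this] with x hx
    rw [EuclideanSpace.real_norm_sq_eq]
    refine Finset.sum_congr rfl fun i _ => ?_
    have e : (G.velocityField u x) i =
        ∑ K ∈ G.intFaces i, (G.openDualCell i K).indicator (fun _ => u i K) x := by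
      refine Finset.sum_congr rfl fun K _ => ?_
      by_cases hm : x ∈ G.dualCell i K
      · rw [indicator_of_mem hm, indicator_of_mem ((hx i K).2 hm)]
      · rw [indicator_of_notMem hm, indicator_of_notMem fun h => hm ((hx i K).1 h)]
    rw [e]
    by_cases hK : ∃ K ∈ G.intFaces i, x ∈ G.openDualCell i K
    · obtain ⟨K, hK, hxK⟩ := hK
      have hL : ∀ L, L ≠ K → x ∉ G.openDualCell i L := fun L hL hxL =>
        Set.disjoint_left.1 (G.disjoint_openDualCell i hL) hxL hxK
      rw [Finset.sum_eq_single_of_mem K hK fun L _ h => indicator_of_notMem (hL L h) _,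
        Finset.sum_eq_single_of_mem K hK fun L _ h => indicator_of_notMem (hL L h) _,
        indicator_of_mem hxK, indicator_of_mem hxK]
    · push Not at hK
      rw [Finset.sum_eq_zero fun K h => indicator_of_notMem (hK K h) _,
        Finset.sum_eq_zero fun K h => indicator_of_notMem (hK K h) _]
      simp
  rw [eLpNorm_eq_lintegral_rpow_enorm_toReal (by norm_num) (by norm_num), Real.sqrt_eq_rpow,
    ← ENNReal.ofReal_rpow_of_nonneg (G.dualInner_self_nonneg u) (by norm_num)]
  simp only [ENNReal.toReal_ofNat]
  refine ENNReal.rpow_le_rpow ?_ (by norm_num)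
  rw [← hval, ofReal_integral_eq_lintegral_ofReal hint (Filter.Eventually.of_forall fun x =>
    Finset.sum_nonneg fun i _ => Finset.sum_nonneg fun K _ =>
      indicator_nonneg (fun _ _ => sq_nonneg _) x)]
  refine (lintegral_mono' Measure.restrict_le_self le_rfl).trans (lintegral_mono_ae ?_)
  filter_upwards [hae] with x hx
  rw [← hx, ← ofReal_norm, ENNReal.ofReal_rpow_of_nonneg (norm_nonneg _) (by norm_num)]
  norm_num

/-! ### Source terms -/

/-- Measurability in time comes from Fubini, and the contraction property dominates the square by
the spatial energy of `f t`, for almost every `t`. -/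
theorem memLp_projVelocity {ν : Measure ℝ} [IsFiniteMeasure ν]
    {f : ℝ → EuclideanSpace ℝ (Fin d) → EuclideanSpace ℝ (Fin d)}
    (hf : MemLp (Function.uncurry f) 2 (ν.prod (volume.restrict Ω))) (i : Fin d) (K : MACIdx d) :
    MemLp (fun t => G.projVelocity (f t) i K) 2 ν := by
  by_cases hK : K ∈ G.intFaces i
  swap
  · simp [projVelocity, hK]
  have hsq := (memLp_two_iff_integrable_sq_norm hf.1).1 hf
  have hmeas : AEStronglyMeasurable (fun t => G.projVelocity (f t) i K) ν := by
    simp only [projVelocity, if_pos hK, setAverage_eq, smul_eq_mul]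
    refine AEStronglyMeasurable.const_mul ?_ _
    have h := hf.1.mono_measure
      (Measure.prod_mono (le_refl ν) (G.restrict_dualCell_le hK))
    exact ((EuclideanSpace.proj i : EuclideanSpace ℝ (Fin d) →L[ℝ] ℝ).continuous
      |>.comp_aestronglyMeasurable h).integral_prod_right'
  rw [memLp_two_iff_integrable_sq hmeas]
  refine (hsq.integral_prod_left.const_mul (G.dualVol i K)⁻¹).mono' (hmeas.pow 2) ?_
  filter_upwards [hf.1.prodMk_left, hsq.prod_right_ae] with t h1 h2
  have hft : MemLp (f t) 2 (volume.restrict Ω) := (memLp_two_iff_integrable_sq_norm h1).2 h2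
  rw [Real.norm_of_nonneg (sq_nonneg _), le_inv_mul_iff₀ (G.dualVol_pos i K)]
  refine le_trans ?_ (G.dualInner_projVelocity_le hft)
  rw [pow_two, ← mul_assoc]
  have hnn : ∀ (j : Fin d) (L : MACIdx d),
      0 ≤ G.dualVol j L * G.projVelocity (f t) j L * G.projVelocity (f t) j L := fun j L => by
    rw [mul_assoc]
    exact mul_nonneg (G.dualVol_pos j L).le (mul_self_nonneg _)
  exact (Finset.single_le_sum (f := fun L =>
    G.dualVol i L * G.projVelocity (f t) i L * G.projVelocity (f t) i L) (fun L _ => hnn i L) hK).trans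
    (Finset.single_le_sum (f := fun j => ∑ L ∈ G.intFaces j,
      G.dualVol j L * G.projVelocity (f t) j L * G.projVelocity (f t) j L)
      (fun j _ => Finset.sum_nonneg fun L _ => hnn j L) (Finset.mem_univ i))

/-- Cauchy-Schwarz in time on each dual cell, followed by the spatial contraction at almost every
time. -/
theorem mul_dualInner_averagedSource_le {τ : ℝ} (hτ : 0 < τ) (n : ℕ)
    {f : ℝ → EuclideanSpace ℝ (Fin d) → EuclideanSpace ℝ (Fin d)}
    (hf : MemLp (Function.uncurry f) 2
      ((volume.restrict (Ioc (n * τ) ((n + 1) * τ))).prod (volume.restrict Ω))) :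
    τ * G.dualInner (G.averagedSource τ f n) (G.averagedSource τ f n) ≤
      ∫ t in (n * τ)..((n + 1) * τ), ∫ x in Ω, ‖f t x‖ ^ 2 := by
  have hle : n * τ ≤ (n + 1) * τ := by nlinarith
  have hp := fun i K => G.memLp_projVelocity hf i K
  have hsq := (memLp_two_iff_integrable_sq_norm hf.1).1 hf
  have hsqi := fun i K => (hp i K).integrable_sq
  rw [intervalIntegral.integral_of_le hle]
  calc τ * G.dualInner (G.averagedSource τ f n) (G.averagedSource τ f n)
      ≤ ∑ i, ∑ K ∈ G.intFaces i, G.dualVol i K *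
          ∫ t in Ioc (n * τ) ((n + 1) * τ), G.projVelocity (f t) i K ^ 2 := by
        simp only [dualInner, Finset.mul_sum]
        refine Finset.sum_le_sum fun i _ => Finset.sum_le_sum fun K _ => ?_
        have h := sq_integral_le (hp i K)
        rw [measureReal_restrict_apply_univ, Real.volume_real_Ioc_of_le hle,
          show (n + 1) * τ - n * τ = τ by ring] at h
        rw [averagedSource, intervalIntegral.integral_of_le hle]
        have h2 := mul_le_mul_of_nonneg_left h
          (mul_nonneg (G.dualVol_pos i K).le (inv_nonneg.2 hτ.le))
        refine le_trans (le_of_eq ?_) (h2.trans (le_of_eq ?_)) <;> field_simp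
    _ = ∫ t in Ioc (n * τ) ((n + 1) * τ),
          G.dualInner (G.projVelocity (f t)) (G.projVelocity (f t)) := by
        simp only [dualInner, mul_assoc, ← pow_two]
        rw [integral_finsetSum _ fun i _ => integrable_finsetSum _ fun K _ =>
          (hsqi i K).const_mul _]
        refine Finset.sum_congr rfl fun i _ => ?_
        rw [integral_finsetSum _ fun K _ => (hsqi i K).const_mul _]
        exact Finset.sum_congr rfl fun K _ => (integral_const_mul _ _).symm
    _ ≤ ∫ t in Ioc (n * τ) ((n + 1) * τ), ∫ x in Ω, ‖f t x‖ ^ 2 := by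
        refine integral_mono_ae ?_ hsq.integral_prod_left ?_
        · simp only [dualInner, mul_assoc, ← pow_two]
          exact integrable_finsetSum _ fun i _ => integrable_finsetSum _ fun K _ =>
            (hsqi i K).const_mul _
        · filter_upwards [hf.1.prodMk_left, hsq.prod_right_ae] with t h1 h2
          exact G.dualInner_projVelocity_le ((memLp_two_iff_integrable_sq_norm h1).2 h2)

theorem sum_mul_dualInner_averagedSource_le {T : ℝ} (hT : 0 < T) {N : ℕ} (hN : 0 < N)
    {f : ℝ → EuclideanSpace ℝ (Fin d) → EuclideanSpace ℝ (Fin d)}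
    (hf : MemLp (Function.uncurry f) 2
      ((volume.restrict (Ioc 0 T)).prod (volume.restrict Ω))) :
    ∑ n ∈ Finset.range N, T / N *
        G.dualInner (G.averagedSource (T / N) f n) (G.averagedSource (T / N) f n) ≤
      ∫ t in (0)..T, ∫ x in Ω, ‖f t x‖ ^ 2 := by
  have hN' : (0 : ℝ) < N := by exact_mod_cast hN
  have hτ : 0 < T / N := div_pos hT hN'
  have hsub : ∀ n < N, Ioc (n * (T / N)) (((n : ℕ) + 1) * (T / N)) ⊆ Ioc 0 T := by
    intro n hn
    refine Ioc_subset_Ioc (by positivity) ?_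
    have h1 : (n : ℝ) + 1 ≤ N := by exact_mod_cast hn
    calc ((n : ℝ) + 1) * (T / N) ≤ N * (T / N) := mul_le_mul_of_nonneg_right h1 hτ.le
      _ = T := by field_simp
  have hsq := ((memLp_two_iff_integrable_sq_norm hf.1).1 hf).integral_prod_left
  refine (Finset.sum_le_sum fun n hn => G.mul_dualInner_averagedSource_le hτ n
    (hf.mono_measure (Measure.prod_mono (Measure.restrict_mono_set _
      (hsub n (Finset.mem_range.1 hn))) le_rfl))).trans (le_of_eq ?_)
  have := intervalIntegral.sum_integral_adjacent_intervals
    (f := fun t => ∫ x in Ω, ‖f t x‖ ^ 2) (μ := volume) (a := fun k : ℕ => k * (T / N)) (n := N) (by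
      intro k hk
      rw [intervalIntegrable_iff_integrableOn_Ioc_of_le (by push_cast; nlinarith)]
      refine IntegrableOn.mono_set hsq ?_
      push_cast
      exact hsub k hk)
  push_cast at this
  rw [this]
  congr 1
  · simp
  · field_simp

end MACGrid

/-! ### Uniform constants and conclusion -/

/-- Discrete solutions are bounded in terms of the data and of the discrete `L²(L²)` norm of the
source term only. -/
theorem exists_bound_of_source_le {d : ℕ} {Ω : Set (EuclideanSpace ℝ (Fin d))} {T : ℝ} (hT : 0 < T)
    {u₀ : EuclideanSpace ℝ (Fin d) → EuclideanSpace ℝ (Fin d)}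
    (hu₀ : MemLp u₀ 2 (volume.restrict Ω))
    {ρ₀ : EuclideanSpace ℝ (Fin d) → ℝ} {ρmin ρmax : ℝ} (hρmin : 0 < ρmin)
    (hρ₀_meas : AEStronglyMeasurable ρ₀ (volume.restrict Ω))
    (hρ₀ : ∀ᵐ x ∂(volume.restrict Ω), ρmin ≤ ρ₀ x ∧ ρ₀ x ≤ ρmax)
    {μ : ℝ → ℝ} (hμ_cont : ContinuousOn μ (Icc ρmin ρmax))
    (hμ_pos : ∀ r ∈ Icc ρmin ρmax, 0 < μ r) (F : ℝ) :
    ∃ C : ℝ, 0 < C ∧ ∀ (G : MACGrid d Ω) (N : ℕ), 0 < N →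
      ∀ (g : ℕ → Fin d → MACIdx d → ℝ)
        (ρ : ℕ → MACIdx d → ℝ) (u : ℕ → Fin d → MACIdx d → ℝ) (p : ℕ → MACIdx d → ℝ),
        ∑ n ∈ Finset.range N, T / N * G.dualInner (g n) (g n) ≤ F →
        G.IsDiscreteSolution (T / N) N μ ρ₀ u₀ g ρ u p →
        ∑ n ∈ Finset.range N, T / N * G.normSq (u (n + 1)) ≤ C ∧
        ∀ n < N, eLpNorm (G.velocityField (u (n + 1))) 2 (volume.restrict Ω)
          ≤ ENNReal.ofReal C := by
  obtain ⟨m, hm0, hm⟩ := isCompact_Icc.exists_forall_le' hμ_cont hμ_pos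
  -- The absolute value keeps `A` nonnegative even when `Ω` is a null set and the bounds on `ρ₀` do
  -- not constrain `ρmax`.
  set A := |ρmax| * ∫ x in Ω, ‖u₀ x‖ ^ 2 with hA
  -- Cauchy-Schwarz in time bounds the `L¹(L²)` norm of the source by its `L²(L²)` norm.
  set B := √T * √F with hB
  set R := √(2 * (A + 2 * B ^ 2 / ρmin) / ρmin) with hR
  have hA0 : 0 ≤ A := mul_nonneg (abs_nonneg _) (integral_nonneg fun x => sq_nonneg _)
  have hS0 : 0 ≤ (A + 2 * B * R) / m := by positivity
  have hR0 : 0 ≤ R := Real.sqrt_nonneg _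
  -- The sum of the two bounds serves both claims; the `1` ensures strict positivity.
  refine ⟨(A + 2 * B * R) / m + R + 1, by positivity, fun G N hN g ρ u p hg h => ?_⟩
  have hN' : (0 : ℝ) < N := by exact_mod_cast hN
  have hτ : 0 < T / N := div_pos hT hN'
  have henergy := h.energy_le hτ hρmin.le (fun K hK => G.projCell_mem hρ₀_meas hρ₀ hK) hm
  have h0 : ρmax * G.dualInner (G.projVelocity u₀) (G.projVelocity u₀) ≤ A :=
    (mul_le_mul_of_nonneg_right (le_abs_self _) (G.dualInner_self_nonneg _)).trans
      (mul_le_mul_of_nonneg_left (G.dualInner_projVelocity_le hu₀) (abs_nonneg _))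
  have hsum : ∑ n ∈ Finset.range N, T / N * √(G.dualInner (g n) (g n)) ≤ B := by
    have hcs := Real.sum_mul_le_sqrt_mul_sqrt (Finset.range N) (fun _ => √(T / N))
      (fun n => √(T / N) * √(G.dualInner (g n) (g n)))
    simp only [mul_pow, Real.sq_sqrt hτ.le, Real.sq_sqrt (G.dualInner_self_nonneg _), ← mul_assoc,
      Real.mul_self_sqrt hτ.le, Finset.sum_const, Finset.card_range, nsmul_eq_mul,
      mul_div_cancel₀ T hN'.ne'] at hcs
    exact hcs.trans (mul_le_mul_of_nonneg_left (Real.sqrt_le_sqrt hg) (Real.sqrt_nonneg _))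
  obtain ⟨h1, h2⟩ := le_of_sq_add_sum_le (A := A) hρmin hm0
    (a := fun n => √(G.dualInner (u n) (u n)))
    (b := fun n => T / N * √(G.dualInner (g n) (g n)))
    (s := fun n => T / N * G.normSq (u (n + 1)))
    (fun n => Real.sqrt_nonneg _) (fun n => mul_nonneg hτ.le (Real.sqrt_nonneg _))
    (fun n => mul_nonneg hτ.le (G.normSq_nonneg _)) hsum
    (fun n hn => (henergy n hn).trans (by linarith))
  refine ⟨by linarith, fun n hn => (G.eLpNorm_velocityField_le _).trans
    (ENNReal.ofReal_le_ofReal ?_)⟩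
  linarith [h2 n hn]

theorem mainTheorem4 {d : ℕ} (hd : d = 2 ∨ d = 3)
    (Ω : Set (EuclideanSpace ℝ (Fin d))) (T : ℝ) (hT : 0 < T)
    (u₀ : EuclideanSpace ℝ (Fin d) → EuclideanSpace ℝ (Fin d))
    (hu₀ : MemLp u₀ 2 (volume.restrict Ω))
    (ρ₀ : EuclideanSpace ℝ (Fin d) → ℝ) (ρmin ρmax : ℝ) (hρmin : 0 < ρmin)
    (hρ₀_meas : AEStronglyMeasurable ρ₀ (volume.restrict Ω))
    (hρ₀ : ∀ᵐ x ∂(volume.restrict Ω), ρmin ≤ ρ₀ x ∧ ρ₀ x ≤ ρmax)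
    (μ : ℝ → ℝ) (hμ_cont : ContinuousOn μ (Set.Icc ρmin ρmax))
    (hμ_pos : ∀ r ∈ Set.Icc ρmin ρmax, 0 < μ r)
    (f : ℝ → EuclideanSpace ℝ (Fin d) → EuclideanSpace ℝ (Fin d))
    (hf : MemLp (Function.uncurry f) 2
      ((volume.restrict (Set.Ioc 0 T)).prod (volume.restrict Ω))) :
    (∃ C : ℝ, 0 < C ∧ ∀ (G : MACGrid d Ω) (N : ℕ), 0 < N →
      ∀ (ρ : ℕ → MACIdx d → ℝ) (u : ℕ → Fin d → MACIdx d → ℝ) (p : ℕ → MACIdx d → ℝ),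
        G.IsDiscreteSolution (T / N) N μ ρ₀ u₀ (G.averagedSource (T / N) f) ρ u p →
        ∑ n ∈ Finset.range N, T / N * G.normSq (u (n + 1)) ≤ C ∧
        ∀ n < N, eLpNorm (G.velocityField (u (n + 1))) 2 (volume.restrict Ω)
          ≤ ENNReal.ofReal C) ∧
    ((∀ t ∈ Set.Ioc 0 T, MemLp (f t) 2 (volume.restrict Ω)) →
      (∃ B : ℝ, ∀ N : ℕ, 0 < N →
        ∑ n ∈ Finset.range N, T / N * ∫ x in Ω, ‖f ((n + 1) * (T / N)) x‖ ^ 2 ≤ B) →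
      ∃ C : ℝ, 0 < C ∧ ∀ (G : MACGrid d Ω) (N : ℕ), 0 < N →
        ∀ (ρ : ℕ → MACIdx d → ℝ) (u : ℕ → Fin d → MACIdx d → ℝ) (p : ℕ → MACIdx d → ℝ),
          G.IsDiscreteSolution (T / N) N μ ρ₀ u₀ (G.sampledSource (T / N) f) ρ u p →
          ∑ n ∈ Finset.range N, T / N * G.normSq (u (n + 1)) ≤ C ∧
          ∀ n < N, eLpNorm (G.velocityField (u (n + 1))) 2 (volume.restrict Ω)
            ≤ ENNReal.ofReal C) := by
  have key := fun F : ℝ =>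
    exists_bound_of_source_le hT hu₀ hρmin hρ₀_meas hρ₀ hμ_cont hμ_pos F
  constructor
  · obtain ⟨C, hC, h⟩ := key (∫ t in (0)..T, ∫ x in Ω, ‖f t x‖ ^ 2)
    exact ⟨C, hC, fun G N hN ρ u p hs =>
      h G N hN _ ρ u p (G.sum_mul_dualInner_averagedSource_le hT hN hf) hs⟩
  · rintro hft ⟨B, hB⟩
    obtain ⟨C, hC, h⟩ := key B
    refine ⟨C, hC, fun G N hN ρ u p hs => h G N hN _ ρ u p (le_trans ?_ (hB N hN)) hs⟩
    have hN' : (0 : ℝ) < N := by exact_mod_cast hN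
    -- The sampling times `(n + 1) T / N` lie in `(0, T]`, where each time slice is assumed to be in
    -- `L²`.
    refine Finset.sum_le_sum fun n hn => mul_le_mul_of_nonneg_left
      (G.dualInner_projVelocity_le (hft _ ⟨by positivity, ?_⟩)) (by positivity)
    have h1 : (n : ℝ) + 1 ≤ N := by exact_mod_cast Finset.mem_range.1 hn
    calc ((n : ℝ) + 1) * (T / N) ≤ N * (T / N) := mul_le_mul_of_nonneg_right h1 (by positivity)
      _ = T := by field_simp
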